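/- Let $p$ be a prime, let $k$ be a closed subfield of $\mathbb{C}_p$ with the restricted valuation $|\cdot|$, and let $V$ be a Banach $k$-vector space, i.e. a $k$-vector space that is complete for a norm $\|\cdot\|$ satisfying $\|v_0-v_1\|\le\max\{\|v_0\|,\|v_1\|\}$ and $\|cv\|=|c|\,\|v\|$. For $S\subseteq V$ let $\langle S\rangle$ be the closure of the $k$-linear span of $S$, and let $\operatorname{rank}(V)$ be the least cardinality of a subset $S\subseteq V$ with $\langle S\rangle=V$. For a set $E$ let $C_0(E,k)$ be the set of functions $c\colon E\to k$ such that $\{e\in E : |c(e)|\ge\varepsilon\}$ is finite for every $\varepsilon>0$, with norm $\|c\|=\sup_{e\in E}|c(e)|$ (equal to $0$ if $E=\emptyset$). A Banach $k$-vector space $W$ is *free* if it has an orthonormal Schauder basis, i.e. a subset $E\subseteq W$ such that $\|e\|=1$ for all $e\in E$, $\|\sum_{e\in E}c(e)e\|=\|c\|$ for all $c\in C_0(E,k)$, and every $w\in W$ equals $\sum_{e\in E}c(e)e$ for some $c\in C_0(E,k)$. The space $V$ is *almost free* if $\langle S\rangle$, with the restricted norm, is free for every $S\subseteq V$ with $\#S<\operatorname{rank}(V)$.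 A filter is *$\lambda$-complete* if it is closed under intersections of non-empty families of fewer than $\lambda$ of its members. A cardinal $\kappa$ is *$\aleph_1$-strongly compact* if $\kappa\ge\aleph_1$ and every proper $\kappa$-complete filter on $\kappa$ is contained in an $\aleph_1$-complete ultrafilter on $\kappa$. Suppose that $\#V=\operatorname{rank}(V)$ and that $\operatorname{rank}(V)$ is $\aleph_1$-strongly compact. Then $V$ is free if and only if $V$ is almost free. -/

import Mathlib

open Cardinal Topology

universe u v

/-- `⟨S⟩`: the closure of the `k`-linear subspace generated by `S`. -/
def closedSpan (k : Type v) [NormedField k] {V : Type u} [NormedAddCommGroup V] [NormedSpace k V]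
    (S : Set V) : Submodule k V :=
  (Submodule.span k S).topologicalClosure

/-- The rank of a Banach space: the least cardinality of a subset `S` with `⟨S⟩ = V`. -/
noncomputable def banachRank (k : Type v) [NormedField k] (V : Type u) [NormedAddCommGroup V]
    [NormedSpace k V] : Cardinal.{u} :=
  sInf {κ : Cardinal.{u} | ∃ S : Set V, #S = κ ∧ closedSpan k S = ⊤}

/-- `E` is an orthonormal Schauder basis of `V`. An element of `C₀(E, k)` is a function
`c : E → k` tending to `0` along the cofinite filter, with norm `⨆ e, ‖c e‖` (which is `0` for
empty `E`). The sum in `norm_sum` always exists when `V` is complete and ultrametric. -/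
structure IsOrthonormalSchauderBasis (k : Type v) [NormedField k] {V : Type u}
    [NormedAddCommGroup V] [NormedSpace k V] (E : Set V) : Prop where
  norm_eq_one : ∀ e ∈ E, ‖e‖ = 1
  norm_sum : ∀ c : E → k, Filter.Tendsto c Filter.cofinite (𝓝 0) →
    ∃ s : V, HasSum (fun e : E => c e • (e : V)) s ∧ ‖s‖ = ⨆ e : E, ‖c e‖
  exists_coeff : ∀ v : V, ∃ c : E → k, Filter.Tendsto c Filter.cofinite (𝓝 0) ∧
    HasSum (fun e : E => c e • (e : V)) v

/-- `V` is free: it admits an orthonormal Schauder basis. -/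
def IsFreeBanach (k : Type v) [NormedField k] (V : Type u) [NormedAddCommGroup V]
    [NormedSpace k V] : Prop :=
  ∃ E : Set V, IsOrthonormalSchauderBasis k E

/-- `V` is `κ`-free: every `⟨S⟩` with `#S < κ` is free (for the restricted norm). -/
def IsCardinalFreeBanach (k : Type v) [NormedField k] (V : Type u) [NormedAddCommGroup V]
    [NormedSpace k V] (κ : Cardinal.{u}) : Prop :=
  ∀ S : Set V, #S < κ → IsFreeBanach k (closedSpan k S)

/-- `V` is almost free: it is `rank(V)`-free. -/
def IsAlmostFreeBanach (k : Type v) [NormedField k] (V : Type u) [NormedAddCommGroup V]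
    [NormedSpace k V] : Prop :=
  IsCardinalFreeBanach k V (banachRank k V)

/-- `κ` is `ℵ₁`-strongly compact: `κ` is uncountable and every proper `κ`-complete filter on a
set of cardinality `κ` is contained in an `ℵ₁`-complete ultrafilter. Here `CardinalInterFilter F c`
says that `F` is closed under intersections of fewer than `c` members, and `U ≤ F` that `U`
contains `F`. -/
def IsAleph1StronglyCompact (κ : Cardinal.{u}) : Prop :=
  ℵ₁ ≤ κ ∧ ∀ F : Filter κ.out, F.NeBot → CardinalInterFilter F κ →
    ∃ U : Ultrafilter κ.out, (U : Filter κ.out) ≤ F ∧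
      CardinalInterFilter (U : Filter κ.out) ℵ₁

/-!
Freeness is studied relative to a subspace: `M` is free over `N` when a family in `M`, orthonormal
modulo `N`, generates `M` topologically together with `N`. Relative freeness is transitive along
well-ordered chains, and over a separable field it passes from `M` to every subspace between `N`
and `M` (a relative form of Gruson's theorem): the coefficient map of a basis sends such a subspace
isometrically onto a space of null families, which is filtered by countably generated pieces.

If `κ = rank V` is regular, strong compactness yields a countably complete ultrafilter concentrating
on generating sets of size less than `κ`. Coordinate maps on the free spaces they span have an
ultralimit, which is a coordinate map on `V`: with respect to a countably complete ultrafilter,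
every function into a separable metric space is constant on a large set.

If `κ` is singular, this is Shelah's singular compactness argument. A small set is pure when its
closed span is a free factor of the closed span of each slightly larger set; pure sets are cofinal,
since a failure repeated along `μ⁺` contradicts freeness in size `μ⁺`. A matrix of pure sets with
extending bases, closed off `ω` times, gives a filtration of `V` of length less than `κ` with free
successive quotients.
-/

section ClosedSpan

variable {k : Type v} [NormedField k] {V : Type u} [NormedAddCommGroup V] [NormedSpace k V]
  {S T : Set V}

theorem subset_closedSpan (S : Set V) : S ⊆ closedSpan k S :=
  Submodule.subset_span.trans (Submodule.le_topologicalClosure _)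

theorem isClosed_closedSpan (S : Set V) : IsClosed (closedSpan k S : Set V) :=
  Submodule.isClosed_topologicalClosure _

theorem closedSpan_minimal {P : Submodule k V} (hS : S ⊆ P) (hP : IsClosed (P : Set V)) :
    closedSpan k S ≤ P :=
  Submodule.topologicalClosure_minimal _ (Submodule.span_le.2 hS) hP

theorem closedSpan_le_closedSpan : closedSpan k S ≤ closedSpan k T ↔ S ⊆ closedSpan k T :=
  ⟨(subset_closedSpan S).trans, fun h => closedSpan_minimal h (isClosed_closedSpan T)⟩

theorem closedSpan_mono (h : S ⊆ T) : closedSpan k S ≤ closedSpan k T :=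
  closedSpan_le_closedSpan.2 (h.trans (subset_closedSpan T))

theorem closedSpan_empty : closedSpan k (∅ : Set V) = ⊥ := by
  rw [closedSpan, Submodule.span_empty]
  exact isClosed_singleton.submodule_topologicalClosure_eq

theorem closedSpan_iUnion_le {ι κ : Sort*} {A : ι → Set V} {B : κ → Set V}
    (h : ∀ i, ∃ j, A i ⊆ closedSpan k (B j)) :
    closedSpan k (⋃ i, A i) ≤ closedSpan k (⋃ j, B j) := by
  refine closedSpan_le_closedSpan.2 (Set.iUnion_subset fun i => ?_)
  obtain ⟨j, hj⟩ := h i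
  exact hj.trans (closedSpan_mono (Set.subset_iUnion B j))

theorem exists_countable_mem_closedSpan {v : V} (hv : v ∈ closedSpan k S) :
    ∃ T ⊆ S, T.Countable ∧ v ∈ closedSpan k T := by
  obtain ⟨x, hx, hlim⟩ := mem_closure_iff_seq_limit.1 hv
  choose T hTS hxT using fun n => Submodule.mem_span_finite_of_mem_span (hx n)
  refine ⟨⋃ n, (T n : Set V), Set.iUnion_subset hTS,
    Set.countable_iUnion fun n => (T n).countable_toSet,
    mem_closure_of_tendsto hlim (Filter.Eventually.of_forall fun n => ?_)⟩
  exact Submodule.span_mono (Set.subset_iUnion (fun n => (T n : Set V)) n) (hxT n)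

end ClosedSpan

section OrthonormalOver

variable {k : Type v} [NormedField k] {V : Type u} [NormedAddCommGroup V] [NormedSpace k V]

/-- `E` is orthonormal modulo `N`: its vectors have norm at most one and every coefficient of a
finite linear combination `w` of `E` is bounded by the norm of every element of `N + w`. A finite
combination is encoded as a finitely supported function `V →₀ k` with support in `E`. -/
def OrthonormalOver (N : Submodule k V) (E : Set V) : Prop :=
  (∀ e ∈ E, ‖e‖ ≤ 1) ∧ ∀ n ∈ N, ∀ b ∈ Finsupp.supported k k E, ∀ e : V,
    ‖b e‖ ≤ ‖n + Finsupp.linearCombination k id b‖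

theorem linearCombination_id_mem_span {E : Set V} {b : V →₀ k}
    (hb : b ∈ Finsupp.supported k k E) :
    Finsupp.linearCombination k id b ∈ Submodule.span k E := by
  simpa using (Finsupp.mem_span_image_iff_linearCombination k (v := id) (s := E)).2 ⟨b, hb, rfl⟩

theorem norm_linearCombination_le [IsUltrametricDist V] {E : Set V} (hE : ∀ e ∈ E, ‖e‖ ≤ 1)
    {b : V →₀ k} (hb : b ∈ Finsupp.supported k k E) {r : ℝ} (hr : 0 ≤ r)
    (hbr : ∀ e, ‖b e‖ ≤ r) :
    ‖Finsupp.linearCombination k (id : V → V) b‖ ≤ r := by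
  rw [Finsupp.linearCombination_apply, Finsupp.sum]
  refine IsUltrametricDist.norm_sum_le_of_forall_le_of_nonneg hr fun e he => ?_
  calc ‖b e • id e‖ = ‖b e‖ * ‖e‖ := norm_smul _ _
    _ ≤ r * 1 := mul_le_mul (hbr e) (hE e (hb he)) (norm_nonneg _) hr
    _ = r := mul_one r

namespace OrthonormalOver

variable {N N' : Submodule k V} {E E' : Set V}

theorem empty : OrthonormalOver N (∅ : Set V) := by
  refine ⟨by simp, fun n _ b hb e => ?_⟩
  have hb0 : b = 0 := by simpa using hb
  simp [hb0]

theorem mono_left (h : OrthonormalOver N' E) (hN : N ≤ N') : OrthonormalOver N E :=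
  ⟨h.1, fun n hn => h.2 n (hN hn)⟩

theorem mono_right (h : OrthonormalOver N E') (hE : E ⊆ E') : OrthonormalOver N E :=
  ⟨fun e he => h.1 e (hE he), fun n hn b hb => h.2 n hn b (Finsupp.supported_mono hE hb)⟩

theorem topologicalClosure (h : OrthonormalOver N E) :
    OrthonormalOver N.topologicalClosure E := by
  refine ⟨h.1, fun n hn b hb e => ?_⟩
  have hclosed : IsClosed {n : V | ‖b e‖ ≤ ‖n + Finsupp.linearCombination k id b‖} :=
    isClosed_le continuous_const (by fun_prop)
  exact closure_minimal (fun n hn => h.2 n hn b hb e) hclosed hn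

theorem union [IsUltrametricDist k] [IsUltrametricDist V] (h : OrthonormalOver N E)
    (h' : OrthonormalOver (N ⊔ Submodule.span k E) E') : OrthonormalOver N (E ∪ E') := by
  refine ⟨fun e he => he.elim (h.1 e) (h'.1 e), fun n hn b hb e => ?_⟩
  rw [Finsupp.supported_union] at hb
  obtain ⟨b₁, hb₁, b₂, hb₂, rfl⟩ := Submodule.mem_sup.1 hb
  rw [map_add, ← add_assoc]
  set x := Finsupp.linearCombination k id b₁
  set y := Finsupp.linearCombination k id b₂
  have hb₂_le : ∀ e, ‖b₂ e‖ ≤ ‖n + x + y‖ :=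
    h'.2 _ (Submodule.add_mem_sup hn (linearCombination_id_mem_span hb₁)) b₂ hb₂
  have hy : ‖y‖ ≤ ‖n + x + y‖ := norm_linearCombination_le h'.1 hb₂ (norm_nonneg _) hb₂_le
  have hx : ‖n + x‖ ≤ ‖n + x + y‖ := by
    simpa [hy] using IsUltrametricDist.norm_add_le_max (n + x + y) (-y)
  exact (IsUltrametricDist.norm_add_le_max _ _).trans
    (max_le ((h.2 n hn b₁ hb₁ e).trans hx) (hb₂_le e))

theorem iUnion_of_directed {ι : Type*} {E : ι → Set V} (hE : Directed (· ⊆ ·) E)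
    (h : ∀ i, OrthonormalOver N (E i)) : OrthonormalOver N (⋃ i, E i) := by
  rcases isEmpty_or_nonempty ι with _ | _
  · simpa using empty
  refine ⟨fun e he => ?_, fun n hn b hb => ?_⟩
  · obtain ⟨i, hi⟩ := Set.mem_iUnion.1 he
    exact (h i).1 e hi
  · obtain ⟨i, hi⟩ := hE.exists_mem_subset_of_finset_subset_biUnion (s := b.support) hb
    exact (h i).2 n hn b hi

theorem iUnion_of_wellFoundedLT [IsUltrametricDist k] [IsUltrametricDist V] {ι : Type*}
    [LinearOrder ι] [WellFoundedLT ι] {E : ι → Set V}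
    (h : ∀ i, OrthonormalOver (N ⊔ Submodule.span k (⋃ j < i, E j)) (E i)) :
    OrthonormalOver N (⋃ i, E i) := by
  have hacc : ∀ i, OrthonormalOver N (Set.accumulate E i) := by
    intro i
    induction i using WellFoundedLT.induction with
    | ind i ih =>
      have hlt : OrthonormalOver N (⋃ j < i, E j) := by
        have hdir : Directed (· ⊆ ·) fun j : Set.Iio i => Set.accumulate E j :=
          (Set.monotone_accumulate.comp (Subtype.mono_coe (· ∈ Set.Iio i))).directed_le
        refine (iUnion_of_directed hdir fun j => ih j j.2).mono_right ?_
        exact Set.iUnion₂_subset fun j hj => Set.subset_iUnion_of_subset ⟨j, hj⟩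
          Set.subset_accumulate
      refine (hlt.union (h i)).mono_right (Set.iUnion₂_subset fun j hj => ?_)
      rcases hj.lt_or_eq with hj | rfl
      · exact Set.subset_union_of_subset_left (Set.subset_biUnion_of_mem (s := Set.Iio i) hj) _
      · exact Set.subset_union_right
  rw [← Set.iUnion_accumulate]
  exact iUnion_of_directed Set.monotone_accumulate.directed_le hacc

theorem map {W : Type*} [NormedAddCommGroup W] [NormedSpace k W] (f : V →ₗᵢ[k] W)
    (h : OrthonormalOver N E) : OrthonormalOver (N.map f.toLinearMap) (f '' E) := by
  classical
  refine ⟨?_, ?_⟩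
  · rintro _ ⟨e, he, rfl⟩
    simpa using h.1 e he
  · rintro _ ⟨n, hn, rfl⟩ b hb w
    rw [← Finsupp.lmapDomain_supported] at hb
    obtain ⟨c, hc, rfl⟩ := hb
    have hcomb : Finsupp.linearCombination k id (Finsupp.lmapDomain k k f c) =
        f (Finsupp.linearCombination k id c) := by
      rw [Finsupp.lmapDomain_apply, Finsupp.linearCombination_mapDomain]
      exact (Finsupp.apply_linearCombination k f.toLinearMap id c).symm
    rw [hcomb, LinearIsometry.coe_toLinearMap, ← map_add, f.norm_map]
    by_cases hw : w ∈ Set.range f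
    · obtain ⟨e, rfl⟩ := hw
      simpa [Finsupp.mapDomain_apply f.injective] using h.2 n hn c hc e
    · simp [Finsupp.mapDomain_of_notMem_range _ _ hw]

end OrthonormalOver

/-- `M` is free relative to `N`: it contains a family, orthonormal modulo `N`, which together with
`N` topologically generates `M`. Taking `N = ⊥` gives free subspaces. -/
def FreeOver (N M : Submodule k V) : Prop :=
  ∃ E : Set V, E ⊆ M ∧ OrthonormalOver N E ∧ M ≤ (N ⊔ Submodule.span k E).topologicalClosure

namespace FreeOver

variable {N N' M M' : Submodule k V}

theorem congr_left (h : FreeOver N M) (hN : N.topologicalClosure = N'.topologicalClosure) :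
    FreeOver N' M := by
  obtain ⟨E, hEM, hE, hM⟩ := h
  refine ⟨E, hEM, hE.topologicalClosure.mono_left (hN ▸ N'.le_topologicalClosure),
    hM.trans (Submodule.topologicalClosure_minimal _ (sup_le ?_ ?_)
      (Submodule.isClosed_topologicalClosure _))⟩
  · exact N.le_topologicalClosure.trans
      (hN ▸ Submodule.topologicalClosure_mono le_sup_left)
  · exact le_sup_right.trans (Submodule.le_topologicalClosure _)

theorem of_le_topologicalClosure (h : FreeOver N M) (hM : M ≤ M')
    (hM' : M' ≤ M.topologicalClosure) : FreeOver N M' := by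
  obtain ⟨E, hEM, hE, hMN⟩ := h
  exact ⟨E, hEM.trans hM, hE, hM'.trans (Submodule.topologicalClosure_minimal _ hMN
    (Submodule.isClosed_topologicalClosure _))⟩

theorem map {W : Type*} [NormedAddCommGroup W] [NormedSpace k W] (f : V →ₗᵢ[k] W)
    (h : FreeOver N M) : FreeOver (N.map f.toLinearMap) (M.map f.toLinearMap) := by
  obtain ⟨E, hEM, hE, hM⟩ := h
  refine ⟨f '' E, Set.image_mono hEM, hE.map f, ?_⟩
  rintro _ ⟨m, hm, rfl⟩
  rw [← LinearIsometry.coe_toLinearMap, ← Submodule.map_span, ← Submodule.map_sup]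
  exact image_closure_subset_closure_image f.continuous ⟨m, hM hm, rfl⟩

theorem iSup [IsUltrametricDist k] [IsUltrametricDist V] {ι : Type*} [LinearOrder ι]
    [WellFoundedLT ι] {M : ι → Submodule k V} (h : ∀ i, FreeOver (N ⊔ ⨆ j < i, M j) (M i)) :
    FreeOver N (N ⊔ ⨆ i, M i) := by
  choose E hEM hE hM using h
  have hspan : ∀ i, Submodule.span k (E i) ≤ M i := fun i => Submodule.span_le.2 (hEM i)
  refine ⟨⋃ i, E i, ?_, .iUnion_of_wellFoundedLT fun i => (hE i).mono_left ?_, ?_⟩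
  · exact Set.iUnion_subset fun i => (hEM i).trans ((le_iSup M i).trans le_sup_right)
  · simp only [Submodule.span_iUnion]
    exact sup_le_sup_left (iSup₂_mono fun j _ => hspan j) N
  set P := (N ⊔ Submodule.span k (⋃ i, E i)).topologicalClosure
  have hNP : N ≤ P := le_sup_left.trans (Submodule.le_topologicalClosure _)
  refine sup_le hNP (iSup_le fun i => ?_)
  induction i using WellFoundedLT.induction with
  | ind i ih =>
    refine (hM i).trans (Submodule.topologicalClosure_minimal _
      (sup_le (sup_le hNP (iSup₂_le ih)) ?_) (Submodule.isClosed_topologicalClosure _))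
    exact (Submodule.span_mono (Set.subset_iUnion E i)).trans
      (le_sup_right.trans (Submodule.le_topologicalClosure _))

theorem iSup_nat [IsUltrametricDist k] [IsUltrametricDist V] {M : ℕ → Submodule k V}
    (hmono : Monotone M) (h : ∀ n, FreeOver (M n) (M (n + 1))) :
    FreeOver (M 0) (⨆ n, M n) := by
  have hlt : ∀ i, M 0 ⊔ ⨆ j < i, M (j + 1) = M i := by
    intro i
    refine le_antisymm (sup_le (hmono i.zero_le) (iSup₂_le fun j hj => hmono hj)) ?_
    cases i with
    | zero => exact le_sup_left
    | succ i =>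
      exact le_sup_of_le_right
        (le_iSup₂ (f := fun j (_ : j < i + 1) => M (j + 1)) i i.lt_succ_self)
  rw [← sup_iSup_nat_succ M]
  exact FreeOver.iSup fun i => (hlt i).symm ▸ h i

end FreeOver

end OrthonormalOver

section NullFamilies

variable {k : Type*} [NormedField k] {I : Type*} {x : I → k}

theorem tendsto_cofinite_of_forall_exists_finsupp
    (h : ∀ r : ℝ, 0 < r → ∃ b : I →₀ k, ∀ i, ‖x i - b i‖ ≤ r) :
    Filter.Tendsto x Filter.cofinite (𝓝 0) := by
  refine Metric.nhds_basis_closedBall.tendsto_right_iff.2 fun r hr => ?_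
  obtain ⟨b, hb⟩ := h r hr
  filter_upwards [b.support.finite_toSet.compl_mem_cofinite] with i hi
  simpa [Finsupp.notMem_support_iff.1 hi] using hb i

theorem finite_setOf_le_norm (hx : Filter.Tendsto x Filter.cofinite (𝓝 0)) {r : ℝ}
    (hr : 0 < r) : {i | r ≤ ‖x i‖}.Finite := by
  have hlt := (tendsto_zero_iff_norm_tendsto_zero.1 hx).eventually (gt_mem_nhds hr)
  simpa [Filter.eventually_cofinite] using hlt

theorem countable_setOf_ne_zero (hx : Filter.Tendsto x Filter.cofinite (𝓝 0)) :
    {i | x i ≠ 0}.Countable := by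
  simpa [Set.compl_def] using hx.countable_compl_preimage_ker

theorem exists_forall_norm_le [Nonempty I] (hx : Filter.Tendsto x Filter.cofinite (𝓝 0)) :
    ∃ i, ∀ j, ‖x j‖ ≤ ‖x i‖ := by
  by_cases hzero : ∀ j, x j = 0
  · exact ⟨Classical.arbitrary I, fun j => by simp [hzero]⟩
  push Not at hzero
  obtain ⟨i₀, hi₀⟩ := hzero
  obtain ⟨i, hi, hmax⟩ := Set.exists_max_image _ (fun j => ‖x j‖)
    (finite_setOf_le_norm hx (norm_pos_iff.2 hi₀)) ⟨i₀, le_refl ‖x i₀‖⟩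
  exact ⟨i, fun j => (le_total ‖x i₀‖ ‖x j‖).elim (hmax j) fun hj => hj.trans hi⟩

theorem countable_range_norm [IsUltrametricDist k] [TopologicalSpace.SeparableSpace k] :
    (Set.range (norm : k → ℝ)).Countable := by
  obtain ⟨D, hD, hdense⟩ := TopologicalSpace.exists_countable_dense k
  refine ((hD.image norm).insert 0).mono ?_
  rintro _ ⟨c, rfl⟩
  by_cases hc : c = 0
  · simp [hc]
  obtain ⟨d, hd, hcd⟩ := hdense.exists_dist_lt c (norm_pos_iff.2 hc)
  refine Or.inr ⟨d, hd, ?_⟩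
  have hlt : ‖c + -d‖ < max ‖c‖ ‖-d‖ := by
    rw [← sub_eq_add_neg, ← dist_eq_norm]
    exact hcd.trans_le (le_max_left _ _)
  simpa using (IsUltrametricDist.norm_eq_of_add_norm_lt_max hlt).symm

end NullFamilies

section Countable

variable {I : Type*}

theorem countable_setOf_finset_subset {C : Set I} (hC : C.Countable) :
    {F : Finset I | (F : Set I) ⊆ C}.Countable :=
  ((Set.countable_ofPred_finite_subset hC).preimage Finset.coe_injective).mono
    fun F (hF : (F : Set I) ⊆ C) => show (F : Set I).Finite ∧ (F : Set I) ⊆ C from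
      ⟨F.finite_toSet, hF⟩

theorem exists_countable_closed_under_finset (T : Finset I → Set I)
    (hT : ∀ F, (T F).Countable) (i : I) :
    ∃ C : Set I, C.Countable ∧ i ∈ C ∧ ∀ F : Finset I, (F : Set I) ⊆ C → T F ⊆ C := by
  let next : Set I → Set I := fun C => C ∪ ⋃ F ∈ {F : Finset I | (F : Set I) ⊆ C}, T F
  let C : ℕ → Set I := fun n => next^[n] {i}
  have hC : ∀ n, C (n + 1) = next (C n) := fun n => Function.iterate_succ_apply' next n {i}
  have hmono : Monotone C :=
    monotone_nat_of_le_succ fun n => (hC n).symm ▸ Set.subset_union_left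
  refine ⟨⋃ n, C n, Set.countable_iUnion fun n => ?_, Set.mem_iUnion.2 ⟨0, rfl⟩, fun F hF => ?_⟩
  · induction n with
    | zero => exact Set.countable_singleton i
    | succ n ih =>
      rw [hC]
      exact ih.union ((countable_setOf_finset_subset ih).biUnion fun F _ => hT F)
  · obtain ⟨n, hn⟩ := hmono.directed_le.exists_mem_subset_of_finset_subset_biUnion hF
    refine Set.subset_iUnion_of_subset (n + 1) ?_
    rw [hC]
    exact Set.subset_union_of_subset_right
      (Set.subset_biUnion_of_mem (u := T) (s := {F : Finset I | (F : Set I) ⊆ C n}) hn) _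

end Countable

section CoordinateMaps

theorem norm_sub_le_max {W : Type*} [SeminormedAddCommGroup W] [IsUltrametricDist W] (x y : W) :
    ‖x - y‖ ≤ max ‖x‖ ‖y‖ := by
  simpa [sub_eq_add_neg] using IsUltrametricDist.norm_add_le_max x (-y)

theorem mem_closure_of_forall_norm_sub_le {W : Type*} [SeminormedAddCommGroup W] {S : Set W}
    {m : W} (h : ∀ r : ℝ, 0 < r → ∃ x ∈ S, ‖m - x‖ ≤ r) : m ∈ closure S := by
  refine (mem_closure_iff_nhds_basis Metric.nhds_basis_closedBall).2 fun r hr => ?_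
  obtain ⟨x, hx, hmx⟩ := h r hr
  exact ⟨x, hx, by rwa [mem_closedBall_iff_norm']⟩

variable {k : Type v} [NormedField k] {W : Type u} [NormedAddCommGroup W] [NormedSpace k W]
  {I : Type*}

/-- `φ` assigns to every vector a null family of coordinates that vanishes on `N` and controls the
distance to `N`. The last field asks slightly more than that the induced map `W ⧸ N → C₀(I, k)` is
isometric: every positive bound `r` of the coordinates of `m`, even their maximum, bounds the norm
of some element of `m + N`. -/
structure IsCoordinateMap (N : Submodule k W) (φ : W →ₗ[k] I → k) : Prop where
  tendsto : ∀ m, Filter.Tendsto (φ m) Filter.cofinite (𝓝 0)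
  norm_apply_le : ∀ m i, ‖φ m i‖ ≤ ‖m‖
  map_eq_zero : ∀ n ∈ N, φ n = 0
  exists_norm_sub_le : ∀ m (r : ℝ), 0 < r → (∀ i, ‖φ m i‖ ≤ r) → ∃ n ∈ N, ‖m - n‖ ≤ r

/-- The vectors whose coordinates vanish outside `J`. -/
def coordinateSubmodule (φ : W →ₗ[k] I → k) (J : Set I) : Submodule k W where
  carrier := {m | ∀ i ∉ J, φ m i = 0}
  zero_mem' := by simp
  add_mem' := fun ha hb i hi => by simp [ha i hi, hb i hi]
  smul_mem' := fun c a ha i hi => by simp [ha i hi]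

theorem coordinateSubmodule_mono (φ : W →ₗ[k] I → k) {J J' : Set I} (h : J ⊆ J') :
    coordinateSubmodule φ J ≤ coordinateSubmodule φ J' :=
  fun _ hm i hi => hm i fun hJ => hi (h hJ)

/-- Bounds on the coordinates outside `J` bound the distance to the vectors supported on `J`. This
is what makes the coordinates outside `J` a coordinate map modulo `coordinateSubmodule φ J`. -/
def IsSaturated (φ : W →ₗ[k] I → k) (J : Set I) : Prop :=
  ∀ m (r : ℝ), 0 < r → (∀ i ∉ J, ‖φ m i‖ ≤ r) → ∃ n ∈ coordinateSubmodule φ J, ‖m - n‖ ≤ r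

namespace IsCoordinateMap

variable {N : Submodule k W} {φ : W →ₗ[k] I → k}

theorem le_coordinateSubmodule (h : IsCoordinateMap N φ) (J : Set I) :
    N ≤ coordinateSubmodule φ J :=
  fun n hn i _ => congrFun (h.map_eq_zero n hn) i

theorem mem_topologicalClosure (h : IsCoordinateMap N φ) {m : W} (hm : φ m = 0) :
    m ∈ N.topologicalClosure :=
  mem_closure_of_forall_norm_sub_le fun r hr =>
    h.exists_norm_sub_le m r hr fun i => by simp [hm, hr.le]

theorem restrict (h : IsCoordinateMap N φ) {J : Set I} (hJ : IsSaturated φ J) :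
    IsCoordinateMap (coordinateSubmodule φ J)
      ((LinearMap.funLeft k k (Subtype.val : (Jᶜ : Set I) → I)).comp φ) where
  tendsto m := (h.tendsto m).comp Subtype.val_injective.tendsto_cofinite
  norm_apply_le m i := h.norm_apply_le m i
  map_eq_zero _ hn := funext fun i => hn i i.2
  exists_norm_sub_le m r hr hm := hJ m r hr fun i hi => hm ⟨i, hi⟩

theorem sup_span_singleton_of_map_eq_zero (h : IsCoordinateMap N φ) {d : W} (hd : φ d = 0) :
    IsCoordinateMap (N ⊔ Submodule.span k {d}) φ where
  tendsto := h.tendsto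
  norm_apply_le := h.norm_apply_le
  map_eq_zero := by
    have hker : N ⊔ Submodule.span k {d} ≤ LinearMap.ker φ :=
      sup_le h.map_eq_zero ((Submodule.span_singleton_le_iff_mem _ _).2 hd)
    exact hker
  exists_norm_sub_le m r hr hm :=
    (h.exists_norm_sub_le m r hr hm).imp fun _ hn => ⟨Submodule.mem_sup_left hn.1, hn.2⟩

theorem exists_pivot (h : IsCoordinateMap N φ) {d : W} (hd : φ d ≠ 0) :
    ∃ e i, ‖e‖ ≤ 1 ∧ φ e i = 1 ∧ N ⊔ Submodule.span k {d} = N ⊔ Submodule.span k {e} := by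
  obtain ⟨i₀, hi₀⟩ := Function.ne_iff.1 hd
  have : Nonempty I := ⟨i₀⟩
  obtain ⟨i, hmax⟩ := exists_forall_norm_le (h.tendsto d)
  have hpos : 0 < ‖φ d i‖ := (norm_pos_iff.2 hi₀).trans_le (hmax i₀)
  set c := φ d i with hc
  have hc0 : c ≠ 0 := norm_pos_iff.1 hpos
  obtain ⟨n, hn, hdn⟩ := h.exists_norm_sub_le d ‖c‖ hpos hmax
  refine ⟨c⁻¹ • (d - n), i, ?_, ?_, ?_⟩
  · rw [norm_smul, norm_inv]
    exact inv_mul_le_one_of_le₀ hdn (norm_nonneg c)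
  · simp [h.map_eq_zero n hn, ← hc, hc0]
  · rw [Submodule.span_singleton_smul_eq hc0.isUnit.inv]
    refine le_antisymm (sup_le le_sup_left ?_) (sup_le le_sup_left ?_) <;>
      rw [Submodule.span_singleton_le_iff_mem]
    · simpa using Submodule.add_mem_sup hn (Submodule.mem_span_singleton_self (d - n))
    · exact Submodule.sub_mem _ (Submodule.mem_sup_right (Submodule.mem_span_singleton_self d))
        (Submodule.mem_sup_left hn)

theorem eliminate [IsUltrametricDist k] (h : IsCoordinateMap N φ) {e : W} {i : I}
    (he : ‖e‖ ≤ 1) (hei : φ e i = 1) :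
    IsCoordinateMap (N ⊔ Submodule.span k {e})
      (φ - ((LinearMap.proj i).comp φ).smulRight (φ e)) where
  tendsto m := by
    have hsub := (h.tendsto m).sub ((h.tendsto e).const_smul (φ m i))
    rwa [smul_zero, sub_zero] at hsub
  norm_apply_le m j := by
    have hle : ‖φ m i • φ e j‖ ≤ ‖m‖ := by
      rw [norm_smul]
      exact (mul_le_of_le_one_right (norm_nonneg _) ((h.norm_apply_le e j).trans he)).trans
        (h.norm_apply_le m i)
    exact (norm_sub_le_max _ _).trans (max_le (h.norm_apply_le m j) hle)
  map_eq_zero := by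
    have hker : N ⊔ Submodule.span k {e} ≤
        LinearMap.ker (φ - ((LinearMap.proj i).comp φ).smulRight (φ e)) := by
      refine sup_le (fun n hn => ?_) ((Submodule.span_singleton_le_iff_mem _ _).2 ?_)
      · simp [h.map_eq_zero n hn]
      · simp [hei]
    exact hker
  exists_norm_sub_le m r hr hm := by
    obtain ⟨n, hn, hmn⟩ := h.exists_norm_sub_le (m - φ m i • e) r hr (by simpa using hm)
    refine ⟨φ m i • e + n, ?_, by rwa [← sub_sub]⟩
    exact Submodule.add_mem _ (Submodule.mem_sup_right
      (Submodule.smul_mem _ _ (Submodule.mem_span_singleton_self e))) (Submodule.mem_sup_left hn)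

theorem orthonormalOver_singleton (h : IsCoordinateMap N φ) {e : W} {i : I} (he : ‖e‖ ≤ 1)
    (hei : φ e i = 1) : OrthonormalOver N {e} := by
  classical
  refine ⟨by simpa using he, fun n hn b hb x => ?_⟩
  obtain ⟨a, rfl⟩ : ∃ a, b = Finsupp.single e a := by
    refine ⟨b e, Finsupp.support_subset_singleton.1 fun y hy => ?_⟩
    simpa using hb hy
  have hle := h.norm_apply_le (n + a • e) i
  simp only [map_add, map_smul, Pi.add_apply, Pi.smul_apply, h.map_eq_zero n hn, hei,
    Pi.zero_apply, zero_add, smul_eq_mul, mul_one] at hle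
  rw [Finsupp.linearCombination_single, id]
  refine le_trans ?_ hle
  rw [Finsupp.single_apply]
  split_ifs <;> simp

theorem freeOver_sup_span_singleton (h : IsCoordinateMap N φ) (d : W) :
    FreeOver N (N ⊔ Submodule.span k {d}) := by
  by_cases hd : φ d = 0
  · refine ⟨∅, by simp, .empty, sup_le ?_ ?_⟩
    · exact le_sup_left.trans (Submodule.le_topologicalClosure _)
    · simpa using h.mem_topologicalClosure hd
  · obtain ⟨e, i, he, hei, hspan⟩ := h.exists_pivot hd
    rw [hspan]
    refine ⟨{e}, ?_, h.orthonormalOver_singleton he hei, Submodule.le_topologicalClosure _⟩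
    simpa using Submodule.mem_sup_right (Submodule.mem_span_singleton_self e)

variable [IsUltrametricDist k]

theorem exists_sup_span_singleton (h : IsCoordinateMap N φ) (d : W) :
    ∃ φ' : W →ₗ[k] I → k, IsCoordinateMap (N ⊔ Submodule.span k {d}) φ' := by
  by_cases hd : φ d = 0
  · exact ⟨φ, h.sup_span_singleton_of_map_eq_zero hd⟩
  · obtain ⟨e, i, he, hei, hspan⟩ := h.exists_pivot hd
    exact ⟨_, hspan ▸ h.eliminate he hei⟩

theorem freeOver_sup_span_of_countable [IsUltrametricDist W] (h : IsCoordinateMap N φ) {D : Set W}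
    (hD : D.Countable) : FreeOver N (N ⊔ Submodule.span k D) := by
  obtain ⟨d, hd⟩ := (hD.insert 0).exists_eq_range (Set.insert_nonempty _ _)
  let M : ℕ → Submodule k W := fun n => N ⊔ Submodule.span k (d '' Set.Iio n)
  have hsucc : ∀ n, M (n + 1) = M n ⊔ Submodule.span k {d n} := fun n => by
    rw [sup_assoc, ← Submodule.span_union, Set.union_singleton, ← Set.image_insert_eq,
      ← Order.Iio_succ_eq_insert, Order.succ_eq_add_one]
  have hcoord : ∀ n, ∃ φ' : W →ₗ[k] I → k, IsCoordinateMap (M n) φ' := by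
    intro n
    induction n with
    | zero => exact ⟨φ, by simpa [M] using h⟩
    | succ n ih =>
      obtain ⟨φ', h'⟩ := ih
      exact hsucc n ▸ h'.exists_sup_span_singleton (d n)
  have hM : ⨆ n, M n = N ⊔ Submodule.span k D := by
    rw [← Submodule.span_insert_zero (s := D), hd, ← sup_iSup, ← Submodule.span_iUnion,
      ← Set.image_iUnion, Set.iUnion_Iio, Set.image_univ]
  have hM0 : M 0 = N := by simp [M]
  rw [← hM, ← hM0]
  refine FreeOver.iSup_nat ?_ fun n => ?_
  · exact monotone_nat_of_le_succ fun n => (hsucc n).symm ▸ le_sup_left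
  · obtain ⟨φ', h'⟩ := hcoord n
    exact hsucc n ▸ h'.freeOver_sup_span_singleton (d n)

end IsCoordinateMap

end CoordinateMaps

section Gruson

variable {k : Type v} [NormedField k] {W : Type u} [NormedAddCommGroup W] [NormedSpace k W]
  {I : Type*} {N : Submodule k W} {φ : W →ₗ[k] I → k}

theorem exists_countable_subset_norm_sub_le [TopologicalSpace.SeparableSpace k]
    (φ : W →ₗ[k] I → k) (F : Finset I) (P : Set W) :
    ∃ S ⊆ P, S.Countable ∧
      ∀ m ∈ P, ∀ r : ℝ, 0 < r → ∃ s ∈ S, ∀ j ∈ F, ‖φ (m - s) j‖ ≤ r := by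
  let g : W → F → k := fun m j => φ m j
  obtain ⟨t, htP, htc, ht⟩ := (TopologicalSpace.IsSeparable.of_separableSpace
    (g '' P)).exists_countable_dense_subset
  obtain ⟨S, hSP, hinj, rfl⟩ :=
    Set.SurjOn.exists_subset_injOn_image_eq (show Set.SurjOn g P t from htP)
  refine ⟨S, hSP, Set.countable_of_injective_of_countable_image hinj htc, fun m hm r hr => ?_⟩
  obtain ⟨_, ⟨s, hs, rfl⟩, hms⟩ := Metric.mem_closure_iff.1 (ht ⟨m, hm, rfl⟩) r hr
  refine ⟨s, hs, fun j hj => ?_⟩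
  rw [map_sub, Pi.sub_apply, ← dist_eq_norm]
  exact (dist_le_pi_dist (g m) (g s) ⟨j, hj⟩).trans hms.le

namespace IsCoordinateMap

theorem exists_countable_approx [IsUltrametricDist k] [TopologicalSpace.SeparableSpace k]
    (h : IsCoordinateMap N φ) (F : Finset I) :
    ∃ S : Set W, S.Countable ∧ ∀ m (r : ℝ), 0 < r → (∀ j ∉ F, ‖φ m j‖ ≤ r) →
      ∃ s ∈ S, ∀ j, ‖φ (m - s) j‖ ≤ r := by
  have := (countable_range_norm (k := k)).to_subtype
  choose S hSP hSc hS using fun ρ : Set.range (norm : k → ℝ) =>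
    exists_countable_subset_norm_sub_le φ F {m | ∀ j ∉ F, ‖φ m j‖ ≤ ρ}
  refine ⟨⋃ ρ, S ρ, Set.countable_iUnion hSc, fun m r hr hm => ?_⟩
  obtain ⟨c, hcr, hc⟩ : ∃ c : k, ‖c‖ ≤ r ∧ ∀ j ∉ F, ‖φ m j‖ ≤ ‖c‖ := by
    rcases isEmpty_or_nonempty {j // j ∉ F} with hF | hF
    · exact ⟨0, by simpa using hr.le, fun j hj => (hF.false ⟨j, hj⟩).elim⟩
    · obtain ⟨i, hi⟩ := exists_forall_norm_le (x := fun j : {j // j ∉ F} => φ m j)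
        ((h.tendsto m).comp Subtype.val_injective.tendsto_cofinite)
      exact ⟨φ m i, hm i i.2, fun j hj => hi ⟨j, hj⟩⟩
  obtain ⟨s, hs, hsr⟩ := hS ⟨‖c‖, c, rfl⟩ m hc r hr
  refine ⟨s, Set.mem_iUnion.2 ⟨_, hs⟩, fun j => ?_⟩
  by_cases hj : j ∈ F
  · exact hsr j hj
  · rw [map_sub, Pi.sub_apply]
    exact (norm_sub_le_max _ _).trans
      (max_le ((hc j hj).trans hcr) ((hSP _ hs j hj).trans hcr))

variable [IsUltrametricDist k] [TopologicalSpace.SeparableSpace k]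

theorem exists_isSaturated_mem [IsUltrametricDist W] (h : IsCoordinateMap N φ) (i : I) :
    ∃ C : Set I, i ∈ C ∧ IsSaturated φ C ∧ FreeOver N (coordinateSubmodule φ C) := by
  choose S hSc hS using h.exists_countable_approx
  obtain ⟨C, hC, hiC, hCS⟩ := exists_countable_closed_under_finset
    (fun F => ⋃ s ∈ S F, {j | φ s j ≠ 0})
    (fun F => (hSc F).biUnion fun s _ => countable_setOf_ne_zero (h.tendsto s)) i
  set D : Set W := ⋃ F ∈ {F : Finset I | (F : Set I) ⊆ C}, S F
  have hDc : D.Countable := (countable_setOf_finset_subset hC).biUnion fun F _ => hSc F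
  have hDC : D ⊆ coordinateSubmodule φ C := by
    refine Set.iUnion₂_subset fun F hF s hs j hj => ?_
    by_contra hne
    exact hj (hCS F hF (Set.mem_biUnion hs hne))
  have happrox : ∀ m (r : ℝ), 0 < r → (∀ j ∉ C, ‖φ m j‖ ≤ r) →
      ∃ x ∈ N ⊔ Submodule.span k D, ‖m - x‖ ≤ r := by
    intro m r hr hm
    have hfin := (finite_setOf_le_norm (h.tendsto m) hr).inter_of_left C
    have hF : (hfin.toFinset : Set I) ⊆ C := by simp
    obtain ⟨s, hs, hsr⟩ := hS hfin.toFinset m r hr fun j hj => by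
      by_cases hjC : j ∈ C
      · exact le_of_lt (by simpa [hjC] using hj)
      · exact hm j hjC
    obtain ⟨n, hn, hmn⟩ := h.exists_norm_sub_le (m - s) r hr hsr
    refine ⟨n + s, Submodule.add_mem_sup hn (Submodule.subset_span ?_), ?_⟩
    · exact Set.mem_biUnion hF hs
    · rwa [add_comm, ← sub_sub]
  have hle : N ⊔ Submodule.span k D ≤ coordinateSubmodule φ C :=
    sup_le (h.le_coordinateSubmodule C) (Submodule.span_le.2 hDC)
  refine ⟨C, hiC, fun m r hr hm => ?_, ?_⟩
  · exact (happrox m r hr hm).imp fun x hx => ⟨hle hx.1, hx.2⟩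
  · refine (h.freeOver_sup_span_of_countable hDc).of_le_topologicalClosure hle fun m hm => ?_
    exact mem_closure_of_forall_norm_sub_le fun r hr =>
      happrox m r hr fun j hj => by simp [hm j hj, hr.le]

theorem exists_isSaturated_extension [IsUltrametricDist W] (h : IsCoordinateMap N φ) {J : Set I}
    (hJ : IsSaturated φ J) (i : I) :
    ∃ J', J ⊆ J' ∧ i ∈ J' ∧ IsSaturated φ J' ∧
      FreeOver (coordinateSubmodule φ J) (coordinateSubmodule φ J') := by
  by_cases hi : i ∈ J
  · exact ⟨J, subset_rfl, hi, hJ, ∅, by simp, .empty,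
      le_sup_left.trans (Submodule.le_topologicalClosure _)⟩
  obtain ⟨C, hiC, hC, hfree⟩ := (h.restrict hJ).exists_isSaturated_mem ⟨i, hi⟩
  have hmem : ∀ j (hj : j ∉ J), j ∉ J ∪ Subtype.val '' C ↔ (⟨j, hj⟩ : (Jᶜ : Set I)) ∉ C := by
    intro j hj
    simp [hj]
  have heq : coordinateSubmodule ((LinearMap.funLeft k k (Subtype.val : (Jᶜ : Set I) → I)).comp φ)
      C = coordinateSubmodule φ (J ∪ Subtype.val '' C) := by
    refine Submodule.ext fun m => ⟨fun hm j hj => ?_, fun hm j hj => ?_⟩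
    · have hjJ : j ∉ J := fun hjJ => hj (Or.inl hjJ)
      exact hm ⟨j, hjJ⟩ ((hmem j hjJ).1 hj)
    · exact hm j ((hmem j j.2).2 hj)
  refine ⟨J ∪ Subtype.val '' C, Set.subset_union_left, Or.inr ⟨⟨i, hi⟩, hiC, rfl⟩, ?_, heq ▸ hfree⟩
  intro m r hr hm
  rw [← heq]
  exact hC m r hr fun j hj => hm j ((hmem j j.2).2 hj)

end IsCoordinateMap

/-- `E` is a basis modulo `N` of the vectors supported on a saturated set `J` of coordinates: the
object to which Zorn's lemma applies in Gruson's theorem. -/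
structure IsPartialBasis (N : Submodule k W) (φ : W →ₗ[k] I → k) (J : Set I) (E : Set W) :
    Prop where
  isSaturated : IsSaturated φ J
  subset : E ⊆ coordinateSubmodule φ J
  orthonormalOver : OrthonormalOver N E
  le_topologicalClosure :
    coordinateSubmodule φ J ≤ (N ⊔ Submodule.span k E).topologicalClosure

namespace IsPartialBasis

theorem empty (h : IsCoordinateMap N φ) : IsPartialBasis N φ ∅ ∅ where
  isSaturated m r hr hm := (h.exists_norm_sub_le m r hr fun i => hm i (Set.notMem_empty i)).imp
    fun _ hn => ⟨h.le_coordinateSubmodule ∅ hn.1, hn.2⟩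
  subset := Set.empty_subset _
  orthonormalOver := .empty
  le_topologicalClosure m hm := by
    simpa using h.mem_topologicalClosure (funext fun i => hm i (Set.notMem_empty i))

theorem iUnion (h : IsCoordinateMap N φ) {ι : Type*} [Nonempty ι] {J : ι → Set I} {E : ι → Set W}
    (hJ : Directed (· ⊆ ·) J) (hE : Directed (· ⊆ ·) E)
    (hJE : ∀ p, IsPartialBasis N φ (J p) (E p)) : IsPartialBasis N φ (⋃ p, J p) (⋃ p, E p) := by
  have happrox : ∀ m (r : ℝ), 0 < r → (∀ i ∉ ⋃ p, J p, ‖φ m i‖ ≤ r) →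
      ∃ p, ∃ n ∈ coordinateSubmodule φ (J p), ‖m - n‖ ≤ r := by
    intro m r hr hm
    have hfin := (finite_setOf_le_norm (h.tendsto m) hr).inter_of_left (⋃ p, J p)
    obtain ⟨p, hp⟩ := hJ.exists_mem_subset_of_finset_subset_biUnion (s := hfin.toFinset) (by simp)
    refine ⟨p, (hJE p).isSaturated m r hr fun i hi => ?_⟩
    by_cases hiJ : i ∈ ⋃ p, J p
    · exact (not_le.1 fun hle => hi (hp (by simpa using ⟨hle, Set.mem_iUnion.1 hiJ⟩))).le
    · exact hm i hiJ
  have hle : ∀ p, coordinateSubmodule φ (J p) ≤ coordinateSubmodule φ (⋃ p, J p) :=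
    fun p => coordinateSubmodule_mono φ (Set.subset_iUnion J p)
  refine ⟨fun m r hr hm => ?_, Set.iUnion_subset fun p => (hJE p).subset.trans (hle p),
    .iUnion_of_directed hE fun p => (hJE p).orthonormalOver, fun m hm => ?_⟩
  · obtain ⟨p, n, hn, hmn⟩ := happrox m r hr hm
    exact ⟨n, hle p hn, hmn⟩
  · refine (Submodule.isClosed_topologicalClosure _).closure_subset
      (mem_closure_of_forall_norm_sub_le fun r hr => ?_)
    obtain ⟨p, n, hn, hmn⟩ := happrox m r hr fun i hi => by simp [hm i hi, hr.le]
    exact ⟨n, Submodule.topologicalClosure_mono (sup_le_sup_left (Submodule.span_mono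
      (Set.subset_iUnion E p)) N) ((hJE p).le_topologicalClosure hn), hmn⟩

theorem exists_extension [IsUltrametricDist k] [TopologicalSpace.SeparableSpace k]
    [IsUltrametricDist W] (h : IsCoordinateMap N φ) {J : Set I} {E : Set W}
    (hJE : IsPartialBasis N φ J E) (i : I) :
    ∃ J' E', J ⊆ J' ∧ E ⊆ E' ∧ i ∈ J' ∧ IsPartialBasis N φ J' E' := by
  obtain ⟨J', hJJ', hi, hJ', E', hE'J', hE', hJ'E'⟩ :=
    h.exists_isSaturated_extension hJE.isSaturated i
  have hNE : N ⊔ Submodule.span k E ≤ coordinateSubmodule φ J :=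
    sup_le (h.le_coordinateSubmodule J) (Submodule.span_le.2 hJE.subset)
  refine ⟨J', E ∪ E', hJJ', Set.subset_union_left, hi, hJ',
    Set.union_subset (hJE.subset.trans (coordinateSubmodule_mono φ hJJ')) hE'J',
    hJE.orthonormalOver.union (hE'.mono_left hNE), hJ'E'.trans ?_⟩
  refine Submodule.topologicalClosure_minimal _ (sup_le (hJE.le_topologicalClosure.trans ?_) ?_)
    (Submodule.isClosed_topologicalClosure _)
  · exact Submodule.topologicalClosure_mono
      (sup_le_sup_left (Submodule.span_mono Set.subset_union_left) N)
  · exact (Submodule.span_mono Set.subset_union_right).trans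
      (le_sup_right.trans (Submodule.le_topologicalClosure _))

end IsPartialBasis

theorem IsCoordinateMap.freeOver_top [IsUltrametricDist k] [TopologicalSpace.SeparableSpace k]
    [IsUltrametricDist W] (h : IsCoordinateMap N φ) : FreeOver N ⊤ := by
  obtain ⟨⟨J, E⟩, -, hmax⟩ := zorn_le_nonempty₀ {p : Set I × Set W | IsPartialBasis N φ p.1 p.2}
    (fun c hc hchain p₀ hp₀ => by
      have : Nonempty c := ⟨⟨p₀, hp₀⟩⟩
      have hdir : Directed (· ≤ ·) (Subtype.val : c → Set I × Set W) := hchain.directed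
      refine ⟨(⋃ p : c, p.1.1, ⋃ p : c, p.1.2), .iUnion h
        (hdir.mono_comp (g := Prod.fst) _ fun _ _ hle => hle.1)
        (hdir.mono_comp (g := Prod.snd) _ fun _ _ hle => hle.2) fun p => hc p.2, fun p hp => ?_⟩
      exact ⟨Set.subset_iUnion (fun p : c => p.1.1) ⟨p, hp⟩,
        Set.subset_iUnion (fun p : c => p.1.2) ⟨p, hp⟩⟩) (∅, ∅) (.empty h)
  have hJE : IsPartialBasis N φ J E := hmax.prop
  have huniv : J = Set.univ := by
    refine Set.eq_univ_of_forall fun i => ?_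
    obtain ⟨J', E', hJ, hE, hi, hJE'⟩ := hJE.exists_extension h i
    exact (hmax.le_of_ge (y := (J', E')) hJE' ⟨hJ, hE⟩).1 hi
  refine ⟨E, fun _ _ => trivial, hJE.orthonormalOver, fun m _ => hJE.le_topologicalClosure ?_⟩
  exact fun i hi => (hi (huniv ▸ Set.mem_univ i)).elim

end Gruson

section Coordinates

variable {k : Type v} [NormedField k] [CompleteSpace k] {V : Type u} [NormedAddCommGroup V]
  [NormedSpace k V] {N M P : Submodule k V} {E : Set V}

theorem exists_linearMap_pi_of_denseRange {X I : Type*} [AddCommGroup X] [Module k X]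
    {g : X →ₗ[k] V} (hg : DenseRange g) {f : X →ₗ[k] I → k} (hf : ∀ x i, ‖f x i‖ ≤ ‖g x‖) :
    ∃ φ : V →ₗ[k] I → k, (∀ v i, ‖φ v i‖ ≤ ‖v‖) ∧ ∀ x, φ (g x) = f x := by
  have hbound : ∀ i x, ‖(LinearMap.proj i).comp f x‖ ≤ 1 * ‖g x‖ := fun i x => by
    simpa using hf x i
  refine ⟨LinearMap.pi fun i => (((LinearMap.proj i).comp f).extendOfNorm g).toLinearMap,
    fun v i => ?_, fun x => funext fun i => ?_⟩
  · simpa using LinearMap.norm_extendOfNorm_apply_le hg 1 (hbound i) v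
  · exact LinearMap.extendOfNorm_eq hg ⟨1, hbound i⟩ x

theorem exists_linearMap_pi_of_le_topologicalClosure {X I : Type*} [AddCommGroup X] [Module k X]
    {g : X →ₗ[k] V} {f : X →ₗ[k] I → k} (hf : ∀ x i, ‖f x i‖ ≤ ‖g x‖)
    (hP : P ≤ (LinearMap.range g).topologicalClosure) :
    ∃ φ : P →ₗ[k] I → k, (∀ m i, ‖φ m i‖ ≤ ‖m‖) ∧ (∀ x (hx : g x ∈ P), φ ⟨g x, hx⟩ = f x) ∧
      ∀ (m : P) (r : ℝ), 0 < r → ∃ x, ‖(m : V) - g x‖ ≤ r ∧ ∀ i, ‖φ m i - f x i‖ ≤ r := by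
  set Q := (LinearMap.range g).topologicalClosure
  let g' : X →ₗ[k] Q := g.codRestrict Q fun x =>
    Submodule.le_topologicalClosure _ (LinearMap.mem_range_self g x)
  have happrox : ∀ (m : Q) (r : ℝ), 0 < r → ∃ x, ‖m - g' x‖ ≤ r := by
    intro m r hr
    obtain ⟨-, ⟨x, rfl⟩, hmx⟩ := Metric.mem_closure_iff.1 m.2 r hr
    exact ⟨x, (dist_eq_norm (m : V) (g x)).ge.trans hmx.le⟩
  have hdense : DenseRange g' := fun m => mem_closure_of_forall_norm_sub_le fun r hr =>
    (happrox m r hr).elim fun x hx => ⟨g' x, ⟨x, rfl⟩, hx⟩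
  obtain ⟨φ, hφ, hφg⟩ := exists_linearMap_pi_of_denseRange hdense hf
  refine ⟨φ.comp (Submodule.inclusion hP), fun m => hφ _, fun x _ => hφg x, fun m r hr => ?_⟩
  obtain ⟨x, hx⟩ := happrox (Submodule.inclusion hP m) r hr
  refine ⟨x, hx, fun i => ?_⟩
  have hle := hφ (Submodule.inclusion hP m - g' x) i
  rw [map_sub, hφg] at hle
  exact hle.trans hx

theorem OrthonormalOver.exists_coordinates (h : OrthonormalOver N E)
    (hP : P ≤ (N ⊔ Submodule.span k E).topologicalClosure) :
    ∃ φ : P →ₗ[k] V → k, (∀ m e, ‖φ m e‖ ≤ ‖m‖) ∧ (∀ m : P, (m : V) ∈ N → φ m = 0) ∧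
      ∀ (m : P) (r : ℝ), 0 < r → ∃ n ∈ N, ∃ b ∈ Finsupp.supported k k E,
        ‖(m : V) - (n + Finsupp.linearCombination k id b)‖ ≤ r ∧ ∀ e, ‖φ m e - b e‖ ≤ r := by
  let extend : (E →₀ k) →ₗ[k] V →₀ k := Finsupp.lmapDomain k k Subtype.val
  have hextend : ∀ b, extend b ∈ Finsupp.supported k k E := fun b => by
    intro e he
    classical
    obtain ⟨e', -, rfl⟩ := Finset.mem_image.1 (Finsupp.mapDomain_support he)
    exact e'.2
  let g : N × (E →₀ k) →ₗ[k] V :=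
    N.subtype.coprod ((Finsupp.linearCombination k id).comp extend)
  have hg : LinearMap.range g = N ⊔ Submodule.span k E := by
    rw [LinearMap.range_coprod, Submodule.range_subtype, Finsupp.linearCombination_comp_lmapDomain,
      Finsupp.range_linearCombination, Function.id_comp, Subtype.range_coe]
  let f : N × (E →₀ k) →ₗ[k] V → k :=
    (LinearMap.pi Finsupp.lapply).comp (extend.comp (LinearMap.snd k N (E →₀ k)))
  obtain ⟨φ, hφ, hφg, happrox⟩ := exists_linearMap_pi_of_le_topologicalClosure (g := g) (f := f)
    (fun x => h.2 x.1 x.1.2 _ (hextend x.2)) (hg ▸ hP)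
  refine ⟨φ, hφ, fun m hm => ?_, fun m r hr => ?_⟩
  · have hgm : g (⟨m, hm⟩, 0) = m := by simp [g]
    have hφm := hφg (⟨m, hm⟩, 0) (by rw [hgm]; exact m.2)
    simp only [hgm] at hφm
    rw [hφm]
    ext e
    simp [f]
  · obtain ⟨x, hx⟩ := happrox m r hr
    exact ⟨x.1, x.1.2, extend x.2, hextend x.2, hx⟩

variable [IsUltrametricDist V] [IsUltrametricDist k]

theorem OrthonormalOver.exists_isCoordinateMap (h : OrthonormalOver N E) (hNP : N ≤ P)
    (hP : P ≤ (N ⊔ Submodule.span k E).topologicalClosure) :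
    ∃ φ : P →ₗ[k] V → k, IsCoordinateMap (N.comap P.subtype) φ := by
  obtain ⟨φ, hφ, hφN, happrox⟩ := h.exists_coordinates hP
  refine ⟨φ, fun m => ?_, hφ, hφN, fun m r hr hm => ?_⟩
  · refine tendsto_cofinite_of_forall_exists_finsupp fun r hr => ?_
    obtain ⟨-, -, b, -, -, hb⟩ := happrox m r hr
    exact ⟨b, hb⟩
  · obtain ⟨n, hn, b, hb, hmn, hφb⟩ := happrox m r hr
    have hbr : ∀ e, ‖b e‖ ≤ r := fun e => by
      have hsub := norm_sub_le_max (φ m e) (φ m e - b e)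
      rw [sub_sub_cancel] at hsub
      exact hsub.trans (max_le (hm e) (hφb e))
    refine ⟨⟨n, hNP hn⟩, hn, ?_⟩
    have hlc := norm_linearCombination_le h.1 hb hr.le hbr
    have hadd := IsUltrametricDist.norm_add_le_max
      ((m : V) - (n + Finsupp.linearCombination k id b)) (Finsupp.linearCombination k id b)
    rw [← sub_sub, sub_add_cancel, sub_sub] at hadd
    exact hadd.trans (max_le hmn hlc)

theorem FreeOver.of_le [TopologicalSpace.SeparableSpace k] (h : FreeOver N M) (hNP : N ≤ P)
    (hPM : P ≤ M) : FreeOver N P := by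
  obtain ⟨E, -, hE, hM⟩ := h
  obtain ⟨φ, hφ⟩ := hE.exists_isCoordinateMap hNP (hPM.trans hM)
  have hmap := hφ.freeOver_top.map P.subtypeₗᵢ
  have hN : (N.comap P.subtype).map P.subtypeₗᵢ.toLinearMap = N :=
    (Submodule.map_comap_subtype P N).trans (inf_eq_right.2 hNP)
  have hP : (⊤ : Submodule k P).map P.subtypeₗᵢ.toLinearMap = P := Submodule.map_subtype_top P
  rwa [hN, hP] at hmap

end Coordinates

section Schauder

variable {k : Type v} [NormedField k] {V : Type u} [NormedAddCommGroup V] [NormedSpace k V]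
  {N : Submodule k V} {E : Set V} {c : E → k} {s : V}

theorem hasSum_linearCombination {b : V →₀ k} (hb : b ∈ Finsupp.supported k k E) :
    HasSum (fun e : E => b e • (e : V)) (Finsupp.linearCombination k id b) := by
  have hV : HasSum (fun e : V => b e • e) (Finsupp.linearCombination k id b) := by
    rw [Finsupp.linearCombination_apply, Finsupp.sum]
    exact hasSum_sum_of_ne_finset_zero fun e he => by simp [Finsupp.notMem_support_iff.1 he]
  refine (hasSum_subtype_iff_of_support_subset fun e he => hb ?_).2 hV
  exact Finsupp.mem_support_iff.2 fun h => he (by simp [h])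

theorem IsFreeBanach.freeOver (h : IsFreeBanach k V) : FreeOver (⊥ : Submodule k V) ⊤ := by
  obtain ⟨E, hE⟩ := h
  refine ⟨E, Set.subset_univ E, ⟨fun e he => (hE.norm_eq_one e he).le, fun n hn b hb e => ?_⟩,
    fun v _ => ?_⟩
  · rw [(Submodule.mem_bot k).1 hn, zero_add]
    by_cases he : e ∈ E
    · have hlim : Filter.Tendsto (fun e : E => b e) Filter.cofinite (𝓝 0) :=
        (tendsto_cofinite_of_forall_exists_finsupp fun r hr =>
          ⟨b, fun e => by simpa using hr.le⟩).comp Subtype.val_injective.tendsto_cofinite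
      obtain ⟨s, hs, hnorm⟩ := hE.norm_sum _ hlim
      rw [← hs.unique (hasSum_linearCombination hb), hnorm]
      exact le_ciSup hlim.norm.bddAbove_range_of_cofinite (⟨e, he⟩ : E)
    · rw [Finsupp.notMem_support_iff.1 fun h => he (hb h), norm_zero]
      exact norm_nonneg _
  · obtain ⟨c, -, hc⟩ := hE.exists_coeff v
    refine mem_closure_of_tendsto hc (Filter.Eventually.of_forall fun T => ?_)
    exact Submodule.sum_mem _ fun e _ => Submodule.smul_mem _ _
      (Submodule.mem_sup_right (Submodule.subset_span e.2))

theorem IsFreeBanach.freeOver_of_submodule {P : Submodule k V} (h : IsFreeBanach k P) :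
    FreeOver ⊥ P := by
  have hmap := h.freeOver.map P.subtypeₗᵢ
  have htop : (⊤ : Submodule k P).map P.subtypeₗᵢ.toLinearMap = P := Submodule.map_subtype_top P
  rwa [htop, Submodule.map_bot] at hmap

theorem OrthonormalOver.norm_coeff_le (h : OrthonormalOver N E)
    (hs : HasSum (fun e : E => c e • (e : V)) s) (e : E) : ‖c e‖ ≤ ‖s‖ := by
  classical
  refine ge_of_tendsto hs.norm ?_
  filter_upwards [Filter.eventually_ge_atTop {e}] with T hT
  have hb : ∑ x ∈ T, Finsupp.single (x : V) (c x) ∈ Finsupp.supported k k E :=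
    Submodule.sum_mem _ fun x _ => Finsupp.single_mem_supported k _ x.2
  have hle := h.2 0 N.zero_mem _ hb e
  rw [zero_add, map_sum, Finsupp.finsetSum_apply] at hle
  simp only [Finsupp.linearCombination_single, id, Finsupp.single_apply] at hle
  simpa [Subtype.coe_inj, Finset.singleton_subset_iff.1 hT] using hle

theorem norm_smul_le_of_norm_le_one {x : V} (hx : ‖x‖ ≤ 1) (a : k) : ‖a • x‖ ≤ ‖a‖ :=
  (norm_smul a x).trans_le (mul_le_of_le_one_right (norm_nonneg a) hx)

variable [IsUltrametricDist V]

theorem norm_le_of_hasSum_smul (hE : ∀ e ∈ E, ‖e‖ ≤ 1)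
    (hs : HasSum (fun e : E => c e • (e : V)) s) {r : ℝ} (hr : 0 ≤ r) (hc : ∀ e, ‖c e‖ ≤ r) :
    ‖s‖ ≤ r :=
  hs.tsum_eq ▸ IsUltrametricDist.norm_tsum_le_of_forall_le_of_nonneg hr fun e =>
    (norm_smul_le_of_norm_le_one (hE e e.2) (c e)).trans (hc e)

variable [CompleteSpace V]

theorem summable_smul_of_tendsto_cofinite (hE : ∀ e ∈ E, ‖e‖ ≤ 1)
    (hc : Filter.Tendsto c Filter.cofinite (𝓝 0)) : Summable fun e : E => c e • (e : V) :=
  NonarchimedeanAddGroup.summable_of_tendsto_cofinite_zero <|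
    squeeze_zero_norm (fun e => norm_smul_le_of_norm_le_one (hE e e.2) (c e))
      (tendsto_zero_iff_norm_tendsto_zero.1 hc)

variable [CompleteSpace k]

theorem OrthonormalOver.exists_hasSum_smul (h : OrthonormalOver (⊥ : Submodule k V) E) {v : V}
    (hv : v ∈ (Submodule.span k E).topologicalClosure) :
    ∃ c : E → k, Filter.Tendsto c Filter.cofinite (𝓝 0) ∧
      HasSum (fun e : E => c e • (e : V)) v := by
  obtain ⟨φ, -, -, happrox⟩ :=
    h.exists_coordinates (P := (Submodule.span k E).topologicalClosure) (by rw [bot_sup_eq])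
  have hlim : Filter.Tendsto (φ ⟨v, hv⟩) Filter.cofinite (𝓝 0) := by
    refine tendsto_cofinite_of_forall_exists_finsupp fun r hr => ?_
    obtain ⟨-, -, b, -, -, hb⟩ := happrox ⟨v, hv⟩ r hr
    exact ⟨b, hb⟩
  have hlimE := hlim.comp (Subtype.val_injective (p := (· ∈ E))).tendsto_cofinite
  obtain ⟨s, hs⟩ := summable_smul_of_tendsto_cofinite h.1 hlimE
  refine ⟨_, hlimE, ?_⟩
  suffices hvs : v - s = 0 by convert hs using 1; exact sub_eq_zero.1 hvs
  refine norm_le_zero_iff.1 (le_of_forall_gt_imp_ge_of_dense fun r hr => ?_)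
  obtain ⟨n, hn, b, hb, hvb, hφb⟩ := happrox ⟨v, hv⟩ r hr
  rw [(Submodule.mem_bot k).1 hn, zero_add] at hvb
  have hdiff := hs.sub (hasSum_linearCombination hb)
  simp only [← sub_smul] at hdiff
  have hsb := norm_le_of_hasSum_smul h.1 hdiff hr.le fun e => hφb e
  rw [← sub_sub_sub_cancel_right v s (Finsupp.linearCombination k id b)]
  exact (norm_sub_le_max _ _).trans (max_le hvb hsb)

theorem FreeOver.isFreeBanach (h : FreeOver (⊥ : Submodule k V) ⊤) : IsFreeBanach k V := by
  obtain ⟨E, -, hE, hdense⟩ := h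
  refine ⟨E, fun e he => (hE.1 e he).antisymm ?_, fun c hc => ?_, fun v => ?_⟩
  · simpa using hE.2 0 (Submodule.zero_mem _) (Finsupp.single e 1)
      (Finsupp.single_mem_supported k 1 he) e
  · obtain ⟨s, hs⟩ := summable_smul_of_tendsto_cofinite hE.1 hc
    refine ⟨s, hs, le_antisymm ?_ (Real.iSup_le (hE.norm_coeff_le hs) (norm_nonneg s))⟩
    exact norm_le_of_hasSum_smul hE.1 hs (Real.iSup_nonneg fun e => norm_nonneg (c e))
      (le_ciSup hc.norm.bddAbove_range_of_cofinite)
  · rw [bot_sup_eq] at hdense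
    exact hE.exists_hasSum_smul (hdense Submodule.mem_top)

theorem IsFreeBanach.submodule [IsUltrametricDist k] [TopologicalSpace.SeparableSpace k]
    (h : IsFreeBanach k V) {P : Submodule k V} (hP : IsClosed (P : Set V)) :
    IsFreeBanach k P := by
  obtain ⟨E, -, hE, hdense⟩ := h.freeOver
  obtain ⟨φ, hφ⟩ := hE.exists_isCoordinateMap bot_le (le_top.trans hdense)
  have := hP.completeSpace_coe
  have hker : (⊥ : Submodule k V).comap P.subtype = ⊥ := P.ker_subtype
  exact (hker ▸ hφ.freeOver_top).isFreeBanach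

end Schauder

section Ultralimit

variable {k : Type v} [NormedField k] {ι X : Type*} {U : Ultrafilter ι}
  [CountableInterFilter (U : Filter ι)]

theorem finite_germ_of_forall_eventually_mem {S : ι → Set X} {G : Set ((U : Filter ι).Germ X)}
    (hS : ∀ᶠ i in U, (S i).Finite)
    (hG : ∀ f : ι → X, (f : (U : Filter ι).Germ X) ∈ G → ∀ᶠ i in U, f i ∈ S i) : G.Finite := by
  by_contra hinf
  let g := Set.Infinite.natEmbedding G hinf
  have hrep : ∀ n, ∃ f : ι → X, (f : (U : Filter ι).Germ X) = g n := fun n =>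
    Quotient.exists_rep (g n).1
  choose f hf using hrep
  have hinj : ∀ᶠ i in U, ∀ m n, f m i = f n i → m = n := by
    refine eventually_countable_forall.2 fun m => eventually_countable_forall.2 fun n => ?_
    refine (U.em fun i => f m i = f n i).elim (fun h => ?_) fun h => h.mono fun i hne heq =>
      absurd heq hne
    have hgerm : (f m : (U : Filter ι).Germ X) = f n := Filter.Germ.coe_eq.2 h
    have hmn : m = n := g.injective (Subtype.ext ((hf m).symm.trans (hgerm.trans (hf n))))
    exact Filter.Eventually.of_forall fun i _ => hmn
  have hmem : ∀ᶠ i in U, ∀ n, f n i ∈ S i :=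
    eventually_countable_forall.2 fun n => hG (f n) (hf n ▸ (g n).2)
  obtain ⟨i, hi, hmem, hfin⟩ := (hinj.and (hmem.and hS)).exists
  exact Set.infinite_of_injective_forall_mem (fun m n => hi m n) hmem hfin

theorem exists_eventually_eq_const [TopologicalSpace.SeparableSpace k] (f : ι → k) :
    ∃ a, ∀ᶠ i in U, f i = a := by
  have := UniformSpace.secondCountable_of_separable k
  exact Filter.exists_eventuallyEq_const_of_forall_separating (fun s : Set k => IsOpen s)
    fun s _ => U.em fun i => f i ∈ s

variable {V : Type u} [NormedAddCommGroup V] [NormedSpace k V] {N : Submodule k V}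
  {P : ι → Submodule k V} {ψ : ι → V →ₗ[k] X → k}

theorem exists_ultralimit [TopologicalSpace.SeparableSpace k] (U : Ultrafilter ι)
    [CountableInterFilter (U : Filter ι)] (ψ : ι → V →ₗ[k] X → k) :
    ∃ Ψ : V →ₗ[k] (U : Filter ι).Germ X → k, ∀ v (f : ι → X), ∀ᶠ i in U, ψ i v (f i) = Ψ v f := by
  choose a ha using fun (v : V) (f : ι → X) =>
    exists_eventually_eq_const (U := U) fun i => ψ i v (f i)
  have ha_eq : ∀ v f b, (∀ᶠ i in U, ψ i v (f i) = b) → a v f = b := fun v f b hb => by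
    obtain ⟨i, hi, hi'⟩ := ((ha v f).and hb).exists
    exact hi.symm.trans hi'
  refine ⟨{ toFun := fun v g => g.liftOn (a v) fun f f' hff' => ha_eq v f _ ?_
            map_add' := fun v w => funext fun g => g.inductionOn fun f => ha_eq _ f _ ?_
            map_smul' := fun c v => funext fun g => g.inductionOn fun f => ha_eq _ f _ ?_ }, ha⟩
  · filter_upwards [hff', ha v f'] with i hi hi'
    rw [hi, hi']
  · filter_upwards [ha v f, ha w f] with i hv hw
    rw [map_add, Pi.add_apply, hv, hw]
    rfl
  · filter_upwards [ha v f] with i hv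
    rw [map_smul, Pi.smul_apply, hv]
    rfl

theorem IsCoordinateMap.of_ultralimit {Ψ : V →ₗ[k] (U : Filter ι).Germ X → k}
    (hψ : ∀ i, IsCoordinateMap (N.comap (P i).subtype) ((ψ i).domRestrict (P i)))
    (hmem : ∀ v, ∀ᶠ i in U, v ∈ P i)
    (hΨ : ∀ v (f : ι → X), ∀ᶠ i in U, ψ i v (f i) = Ψ v f) : IsCoordinateMap N Ψ := by
  refine ⟨fun v => ?_, fun v g => ?_, fun n hn => funext fun g => ?_, fun v r hr hv => ?_⟩
  · rw [tendsto_zero_iff_norm_tendsto_zero]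
    refine (Metric.nhds_basis_ball).tendsto_right_iff.2 fun r hr => ?_
    refine finite_germ_of_forall_eventually_mem (S := fun i => {x | r ≤ ‖ψ i v x‖}) ?_ ?_
    · filter_upwards [hmem v] with i hi
      exact finite_setOf_le_norm ((hψ i).tendsto ⟨v, hi⟩) hr
    · intro f hf
      filter_upwards [hΨ v f] with i hi
      simpa [hi] using hf
  · induction g using Filter.Germ.inductionOn with | h f =>
    obtain ⟨i, hi, hvi⟩ := ((hΨ v f).and (hmem v)).exists
    exact hi ▸ (hψ i).norm_apply_le ⟨v, hvi⟩ (f i)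
  · induction g using Filter.Germ.inductionOn with | h f =>
    obtain ⟨i, hi, hni⟩ := ((hΨ n f).and (hmem n)).exists
    rw [← hi]
    exact congr_fun ((hψ i).map_eq_zero ⟨n, hni⟩ hn) (f i)
  · have hle : ∀ᶠ i in U, ∀ x, ‖ψ i v x‖ ≤ r := by
      refine (U.em fun i => ∀ x, ‖ψ i v x‖ ≤ r).resolve_right fun hlt => ?_
      simp only [not_forall] at hlt
      obtain ⟨x, -⟩ := hlt.exists.choose_spec
      have : Nonempty X := ⟨x⟩
      obtain ⟨f, hf⟩ := Filter.skolem.1 hlt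
      obtain ⟨i, hi, hfi⟩ := ((hΨ v f).and hf).exists
      exact hfi (hi ▸ hv f)
    obtain ⟨i, hi, hvi⟩ := (hle.and (hmem v)).exists
    obtain ⟨n, hn, hvn⟩ := (hψ i).exists_norm_sub_le ⟨v, hvi⟩ r hr hi
    exact ⟨n, hn, hvn⟩

theorem freeOver_top_of_ultrafilter [CompleteSpace k] [IsUltrametricDist k]
    [TopologicalSpace.SeparableSpace k] [IsUltrametricDist V] (U : Ultrafilter ι)
    [CountableInterFilter (U : Filter ι)] (hN : ∀ i, N ≤ P i) (hP : ∀ i, FreeOver N (P i))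
    (hmem : ∀ v, ∀ᶠ i in U, v ∈ P i) : FreeOver N ⊤ := by
  choose E _ hE hdense using hP
  choose φ hφ using fun i => (hE i).exists_isCoordinateMap (hN i) (hdense i)
  choose ψ hψ using fun i => (φ i).exists_extend
  obtain ⟨Ψ, hΨ⟩ := exists_ultralimit U ψ
  have hres : ∀ i, (ψ i).domRestrict (P i) = φ i := hψ
  exact (IsCoordinateMap.of_ultralimit (fun i => (hres i).symm ▸ hφ i) hmem hΨ).freeOver_top

end Ultralimit

section Regular

theorem mk_Iic_toType_ord_lt {κ : Cardinal.{u}} (hκ : ℵ₀ ≤ κ) (i : κ.ord.ToType) :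
    #(Set.Iic i) < κ := by
  rw [← Set.Iio_insert]
  refine mk_insert_le.trans_lt (add_lt_of_lt hκ ?_ (one_lt_aleph0.trans_le hκ))
  simpa using mk_Iio_lt i (by simp)

theorem IsAleph1StronglyCompact.exists_fine_ultrafilter {κ : Cardinal.{u}}
    (hκ : IsAleph1StronglyCompact κ) (hreg : κ.IsRegular) {α : Type u} {S : Set α} (hS : #S ≤ κ) :
    ∃ (U : Ultrafilter κ.out) (T : κ.out → Set α), CountableInterFilter (U : Filter κ.out) ∧
      (∀ i, #(T i) < κ) ∧ ∀ a ∈ S, ∀ᶠ i in U, a ∈ T i := by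
  have hne : (Filter.cocardinal κ.out hreg).NeBot := by
    rw [← inf_top_eq (Filter.cocardinal κ.out hreg), ← Filter.principal_univ]
    exact Filter.cocardinal_inf_principal_neBot_iff.2 (by simp)
  obtain ⟨U, hU, hUc⟩ := hκ.2 _ hne inferInstance
  obtain ⟨e⟩ : Nonempty (κ.out ≃ κ.ord.ToType) := Cardinal.eq.1 (by simp)
  obtain ⟨g⟩ : Nonempty (S ↪ κ.ord.ToType) := by
    rwa [← Cardinal.le_def, mk_ord_toType]
  refine ⟨U, fun i => (↑) '' (g ⁻¹' Set.Iic (e i)), cardinalInterFilter_aleph_one_iff.1 hUc,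
    fun i => ?_, fun a ha => hU ?_⟩
  · exact mk_image_le.trans_lt ((mk_preimage_of_injective g _ g.injective).trans_lt
      (mk_Iic_toType_ord_lt hreg.aleph0_le _))
  · refine Filter.mem_cocardinal.2 ((mk_le_mk_of_subset ?_).trans_lt
      ((mk_preimage_of_injective e _ e.injective).trans_lt
        (mk_Iic_toType_ord_lt hreg.aleph0_le (g ⟨a, ha⟩))))
    intro i hi
    exact le_of_not_ge fun hle : g ⟨a, ha⟩ ≤ e i => hi ⟨⟨a, ha⟩, hle, rfl⟩

variable {k : Type v} [NormedField k] [IsUltrametricDist k] [CompleteSpace k]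
  [TopologicalSpace.SeparableSpace k] {V : Type u} [NormedAddCommGroup V] [NormedSpace k V]
  [IsUltrametricDist V]

theorem IsAleph1StronglyCompact.freeOver_top {κ : Cardinal.{u}} (hκ : IsAleph1StronglyCompact κ)
    (hreg : κ.IsRegular) {S : Set V} (hS : #S ≤ κ) (hspan : closedSpan k S = ⊤)
    (hfree : ∀ T : Set V, #T < κ → FreeOver ⊥ (closedSpan k T)) :
    FreeOver (⊥ : Submodule k V) ⊤ := by
  obtain ⟨U, T, hU, hT, hST⟩ := hκ.exists_fine_ultrafilter hreg hS
  refine freeOver_top_of_ultrafilter U (fun _ => bot_le) (fun i => hfree (T i) (hT i)) fun v => ?_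
  obtain ⟨C, hCS, hC, hv⟩ := exists_countable_mem_closedSpan
    (hspan.symm ▸ Submodule.mem_top : v ∈ closedSpan k S)
  have hCT : ∀ᶠ i in U, ∀ c ∈ C, c ∈ T i :=
    (eventually_countable_ball hC).2 fun c hc => hST c (hCS hc)
  filter_upwards [hCT] with i hi
  exact closedSpan_mono hi hv

end Regular

section Cardinality

theorem mk_iUnion_le_of_le {α ι : Type u} {μ : Cardinal.{u}} (hμ : ℵ₀ ≤ μ) (hι : #ι ≤ μ)
    {S : ι → Set α} (hS : ∀ i, #(S i) ≤ μ) : #(⋃ i, S i) ≤ μ :=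
  (mk_iUnion_le S).trans (mul_le_of_le hμ hι (ciSup_le' hS))

theorem mk_union_le_of_le {α : Type u} {μ : Cardinal.{u}} (hμ : ℵ₀ ≤ μ) {S T : Set α}
    (hS : #S ≤ μ) (hT : #T ≤ μ) : #(S ∪ T : Set α) ≤ μ :=
  (mk_union_le S T).trans (add_le_of_le hμ hS hT)

theorem mk_le_of_countable {α : Type u} {μ : Cardinal.{u}} (hμ : ℵ₀ ≤ μ) {S : Set α}
    (hS : S.Countable) : #S ≤ μ :=
  (le_aleph0_iff_set_countable.2 hS).trans hμ

theorem exists_forall_lt_toType_ord {κ : Cardinal.{u}} (hκ : κ.IsRegular)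
    {S : Set κ.ord.ToType} (hS : #S < κ) : ∃ j, ∀ i ∈ S, i < j := by
  have hcof : ¬ IsCofinal S := fun h =>
    (Order.cof_le h).not_gt (by rwa [Ordinal.cof_toType, hκ.cof_ord])
  exact not_isCofinal_iff.1 hcof

theorem exists_subset_of_subset_iUnion {κ : Cardinal.{u}} (hκ : κ.IsRegular) {α : Type u}
    {B : κ.ord.ToType → Set α} (hB : Monotone B) {C : Set α} (hC : #C < κ)
    (hCB : C ⊆ ⋃ i, B i) : ∃ j, C ⊆ B j := by
  choose l hl using fun c : C => Set.mem_iUnion.1 (hCB c.2)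
  obtain ⟨j, hj⟩ := exists_forall_lt_toType_ord hκ (mk_range_le.trans_lt hC : #(Set.range l) < κ)
  exact ⟨j, fun c hc => hB (hj _ ⟨⟨c, hc⟩, rfl⟩).le (hl ⟨c, hc⟩)⟩

theorem exists_continuous_chain {μ : Cardinal.{u}} (hμ : ℵ₀ ≤ μ) {α : Type u} {A : Set α}
    (hA : #A ≤ μ) {G : Set α → Set α} (hG : ∀ B, #(G B) ≤ μ) :
    ∃ B : (Order.succ μ).ord.ToType → Set α, Monotone B ∧ (∀ i, A ⊆ B i) ∧
      (∀ i, #(B i) ≤ μ) ∧ (∀ i j, i < j → G (B i) ⊆ B j) ∧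
      ∀ ν : ℕ → (Order.succ μ).ord.ToType, ∃ m, B m = ⋃ n, B (ν n) := by
  let B : (Order.succ μ).ord.ToType → Set α :=
    wellFounded_lt.fix fun i rec => A ∪ ⋃ j : Set.Iio i, G (rec j j.2)
  have hB : ∀ i, B i = A ∪ ⋃ j : Set.Iio i, G (B j) := fun i => wellFounded_lt.fix_eq _ i
  have hAB : ∀ i, A ⊆ B i := fun i => (hB i).symm ▸ Set.subset_union_left
  have hGB : ∀ i j, i < j → G (B i) ⊆ B j := fun i j hij => (hB j).symm ▸
    Set.subset_union_of_subset_right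
      (Set.subset_iUnion (fun j : Set.Iio j => G (B j)) ⟨i, hij⟩) A
  have hmono : Monotone B := fun i j hij => (hB i).trans_subset
    (Set.union_subset (hAB j) (Set.iUnion_subset fun l => hGB l j (l.2.trans_le hij)))
  refine ⟨B, hmono, hAB, fun i => ?_, hGB, fun ν => ?_⟩
  · have hi : #(Set.Iio i) ≤ μ := Order.lt_succ_iff.1
      (by simpa using mk_Iio_lt i (by simp))
    exact hB i ▸ mk_union_le_of_le hμ hA (mk_iUnion_le_of_le hμ hi fun j => hG (B j))
  · obtain ⟨b, hb⟩ := exists_forall_lt_toType_ord (isRegular_succ hμ)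
      (Order.lt_succ_iff.2 (mk_le_of_countable hμ (Set.countable_range ν)))
    obtain ⟨m, hm, hmin⟩ := wellFounded_lt.has_min {m | ∀ n, ν n ≤ m}
      ⟨b, fun n => (hb _ ⟨n, rfl⟩).le⟩
    refine ⟨m, Set.Subset.antisymm ?_ (Set.iUnion_subset fun n => hmono (hm n))⟩
    refine (hB m).trans_subset (Set.union_subset
      (Set.subset_iUnion_of_subset 0 (hAB (ν 0))) (Set.iUnion_subset fun j => ?_))
    obtain ⟨n, hn⟩ : ∃ n, j < ν n := by
      by_contra! h
      exact hmin j h j.2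
    exact Set.subset_iUnion_of_subset n (hGB _ _ hn)

end Cardinality

section Pure

variable {k : Type v} [NormedField k] {V : Type u} [NormedAddCommGroup V] [NormedSpace k V]

theorem exists_subset_mk_le_subset_closedSpan {μ : Cardinal.{u}} (hμ : ℵ₀ ≤ μ) {A S : Set V}
    (hA : #A ≤ μ) (hAS : A ⊆ closedSpan k S) : ∃ F ⊆ S, #F ≤ μ ∧ A ⊆ closedSpan k F := by
  choose T hTS hT hAT using fun a : A => exists_countable_mem_closedSpan (hAS a.2)
  exact ⟨⋃ a, T a, Set.iUnion_subset hTS,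
    mk_iUnion_le_of_le hμ hA fun a => mk_le_of_countable hμ (hT a),
    fun a ha => closedSpan_mono (Set.subset_iUnion T ⟨a, ha⟩) (hAT ⟨a, ha⟩)⟩

theorem exists_closedSpan_iUnion_nat_eq {μ : Cardinal.{u}} (hμ : ℵ₀ ≤ μ)
    {B : (Order.succ μ).ord.ToType → Set V} (hB : Monotone B) (hBμ : ∀ i, #(B i) ≤ μ) {E : Set V}
    (hE : closedSpan k (⋃ i, B i) = closedSpan k E) :
    ∃ ν : ℕ → (Order.succ μ).ord.ToType,
      ∃ F ⊆ E, closedSpan k (⋃ n, B (ν n)) = closedSpan k F := by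
  have hreg := isRegular_succ hμ
  have hstep : ∀ i, ∃ j, ∃ F ⊆ E, B i ⊆ closedSpan k F ∧ F ⊆ closedSpan k (B j) := by
    intro i
    obtain ⟨F, hFE, hF, hBF⟩ := exists_subset_mk_le_subset_closedSpan hμ (hBμ i)
      ((Set.subset_iUnion B i).trans ((subset_closedSpan _).trans hE.le))
    obtain ⟨C, hCB, hC, hFC⟩ := exists_subset_mk_le_subset_closedSpan hμ hF
      (hFE.trans ((subset_closedSpan E).trans hE.ge))
    obtain ⟨j, hCj⟩ := exists_subset_of_subset_iUnion hreg hB (Order.lt_succ_iff.2 hC) hCB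
    exact ⟨j, F, hFE, hBF, hFC.trans (closedSpan_mono hCj)⟩
  choose next F hFE hBF hFB using hstep
  obtain ⟨i₀, -⟩ := exists_forall_lt_toType_ord hreg (S := ∅) (by simp)
  have hsucc : ∀ n, next^[n + 1] i₀ = next (next^[n] i₀) := fun n =>
    Function.iterate_succ_apply' next n i₀
  refine ⟨fun n => next^[n] i₀, ⋃ n, F (next^[n] i₀), Set.iUnion_subset fun n => hFE _,
    le_antisymm ?_ ?_⟩
  · exact closedSpan_iUnion_le fun n => ⟨n, hBF _⟩
  · exact closedSpan_iUnion_le fun n => ⟨n + 1, by simpa only [hsucc] using hFB _⟩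

theorem OrthonormalOver.sdiff {N : Submodule k V} {E F : Set V} (h : OrthonormalOver N E)
    (hF : F ⊆ E) : OrthonormalOver (N ⊔ Submodule.span k F) (E \ F) := by
  refine ⟨fun e he => h.1 e he.1, fun n hn b hb e => ?_⟩
  obtain ⟨x, hx, y, hy, rfl⟩ := Submodule.mem_sup.1 hn
  obtain ⟨a, ha, rfl⟩ := (Finsupp.mem_span_image_iff_linearCombination k
    (v := (id : V → V)) (s := F)).1 (by simpa using hy)
  by_cases he : e ∈ E \ F
  · have hae : a e = 0 := (Finsupp.mem_supported' k a).1 ha e he.2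
    have hab := h.2 x hx (a + b) (Submodule.add_mem _ (Finsupp.supported_mono hF ha)
      (Finsupp.supported_mono Set.sdiff_subset hb)) e
    rwa [Finsupp.add_apply, hae, zero_add, map_add, ← add_assoc] at hab
  · simp [(Finsupp.mem_supported' k b).1 hb e he]

theorem OrthonormalOver.freeOver_of_subset {E F : Set V}
    (h : OrthonormalOver (⊥ : Submodule k V) E) (hF : F ⊆ E) :
    FreeOver (closedSpan k F) (closedSpan k E) := by
  have hEF := (h.sdiff hF).topologicalClosure
  rw [bot_sup_eq] at hEF
  refine ⟨E \ F, Set.sdiff_subset.trans (subset_closedSpan E), hEF,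
    Submodule.topologicalClosure_mono (Submodule.span_le.2 fun e he => ?_)⟩
  by_cases heF : e ∈ F
  · exact Submodule.mem_sup_left (subset_closedSpan F heF)
  · exact Submodule.mem_sup_right (Submodule.subset_span ⟨he, heF⟩)

theorem OrthonormalOver.exists_extension [IsUltrametricDist k] [IsUltrametricDist V]
    {A A' E : Set V} (h : OrthonormalOver (⊥ : Submodule k V) E)
    (hE : closedSpan k A = closedSpan k E) (hA : A ⊆ A')
    (hfree : FreeOver (closedSpan k A) (closedSpan k A')) :
    ∃ E', E ⊆ E' ∧ OrthonormalOver (⊥ : Submodule k V) E' ∧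
      closedSpan k A' = closedSpan k E' := by
  obtain ⟨E₁, hE₁A', hE₁, hA'⟩ := hfree
  have hspan : Submodule.span k E ≤ closedSpan k A := hE ▸ Submodule.le_topologicalClosure _
  refine ⟨E ∪ E₁, Set.subset_union_left, h.union (hE₁.mono_left (by rwa [bot_sup_eq])),
    le_antisymm (hA'.trans (Submodule.topologicalClosure_minimal _ (sup_le ?_ ?_)
      (isClosed_closedSpan _))) (closedSpan_le_closedSpan.2 (Set.union_subset ?_ hE₁A'))⟩
  · exact hE.le.trans (closedSpan_mono Set.subset_union_left)
  · exact Submodule.span_le.2 (Set.subset_union_right.trans (subset_closedSpan _))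
  · exact (subset_closedSpan E).trans (hE.ge.trans (closedSpan_mono hA))

theorem FreeOver.exists_orthonormalOver [IsUltrametricDist k] [IsUltrametricDist V] {A : Set V}
    (h : FreeOver ⊥ (closedSpan k A)) :
    ∃ E, OrthonormalOver (⊥ : Submodule k V) E ∧ closedSpan k A = closedSpan k E := by
  rw [← closedSpan_empty] at h
  obtain ⟨E, -, hE, hAE⟩ := OrthonormalOver.empty.exists_extension rfl (Set.empty_subset A) h
  exact ⟨E, hE, hAE⟩

variable (k) in
/-- The `μ`-purity of Shelah's singular compactness theorem: the closed span of `A` is a free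
factor of the closed span of every larger set of cardinality at most `μ`. -/
def IsPure (μ : Cardinal.{u}) (A : Set V) : Prop :=
  ∀ C, A ⊆ C → #C ≤ μ → FreeOver (closedSpan k A) (closedSpan k C)

/- Otherwise every small set `B` has an extension `G B` over which it is not a free factor.
Iterating `G` along `μ⁺` yields a set with a free closed span, and a countable closing-off argument
finds a stage `B m` spanned by part of a basis, hence a free factor of `G (B m)`. -/
theorem exists_isPure [IsUltrametricDist k] [CompleteSpace k] [TopologicalSpace.SeparableSpace k]
    [IsUltrametricDist V] {μ : Cardinal.{u}} (hμ : ℵ₀ ≤ μ)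
    (hfree : ∀ S : Set V, #S ≤ Order.succ μ → FreeOver ⊥ (closedSpan k S))
    {A : Set V} (hA : #A ≤ μ) : ∃ A', A ⊆ A' ∧ #A' ≤ μ ∧ IsPure k μ A' := by
  by_contra! hcon
  have hG : ∀ B : Set V, ∃ C : Set V, #C ≤ μ ∧ (A ⊆ B → #B ≤ μ →
      B ⊆ C ∧ ¬ FreeOver (closedSpan k B) (closedSpan k C)) := by
    intro B
    by_cases hB : A ⊆ B ∧ #B ≤ μ
    · have hnot := hcon B hB.1 hB.2
      simp only [IsPure, not_forall] at hnot
      obtain ⟨C, hBC, hC, hnfree⟩ := hnot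
      exact ⟨C, hC, fun _ _ => ⟨hBC, hnfree⟩⟩
    · exact ⟨∅, by simp, fun hAB hBμ => absurd ⟨hAB, hBμ⟩ hB⟩
  choose G hGμ hG using hG
  obtain ⟨B, hmono, hAB, hBμ, hGB, hlim⟩ := exists_continuous_chain hμ hA hGμ
  obtain ⟨E, hE, hspan⟩ := (hfree (⋃ i, B i) (mk_iUnion_le_of_le (hμ.trans (Order.le_succ μ))
    (by simp) fun i => (hBμ i).trans (Order.le_succ μ))).exists_orthonormalOver
  obtain ⟨ν, F, hFE, hF⟩ := exists_closedSpan_iUnion_nat_eq hμ hmono hBμ hspan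
  obtain ⟨m, hm⟩ := hlim ν
  obtain ⟨m', hm'⟩ := exists_forall_lt_toType_ord (isRegular_succ hμ) (S := {m})
    (by simpa using one_lt_aleph0.trans_le (hμ.trans (Order.le_succ μ)))
  have hfactor : FreeOver (closedSpan k (B m)) (closedSpan k (⋃ i, B i)) := by
    rw [hm, hF, hspan]
    exact hE.freeOver_of_subset hFE
  obtain ⟨hBG, hnfree⟩ := hG (B m) (hAB m) (hBμ m)
  exact hnfree (hfactor.of_le (closedSpan_mono hBG)
    (closedSpan_mono (Set.subset_iUnion_of_subset m' (hGB m m' (hm' m rfl)))))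

end Pure

section Singular

theorem exists_filtration_of_isSingular {κ : Cardinal.{u}} (hκ : κ.IsSingular) {α : Type u}
    {S : Set α} (hS : #S ≤ κ) :
    ∃ (Λ : Type u) (_ : LinearOrder Λ) (_ : WellFoundedLT Λ) (D : Λ → Set α),
      #Λ < κ ∧ Monotone D ∧ (∀ i, #(D i) < κ) ∧ S ⊆ ⋃ i, D i := by
  obtain ⟨g⟩ : Nonempty (S ↪ κ.ord.ToType) := by
    rwa [← Cardinal.le_def, mk_ord_toType]
  obtain ⟨Λ, hΛ, hΛκ⟩ := Order.exists_cof_eq κ.ord.ToType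
  rw [Ordinal.cof_toType] at hΛκ
  refine ⟨Λ, inferInstance, inferInstance, fun i => (↑) '' (g ⁻¹' Set.Iic (i : κ.ord.ToType)),
    hΛκ ▸ hκ.cof_ord_lt, fun i j hij => ?_, fun i => ?_, fun a ha => ?_⟩
  · exact Set.image_mono (Set.preimage_mono (Set.Iic_subset_Iic.2 hij))
  · exact mk_image_le.trans_lt ((mk_preimage_of_injective g _ g.injective).trans_lt
      (mk_Iic_toType_ord_lt hκ.aleph0_le _))
  · obtain ⟨i, hi, hai⟩ := hΛ (g ⟨a, ha⟩)
    exact Set.mem_iUnion.2 ⟨⟨i, hi⟩, ⟨a, ha⟩, hai, rfl⟩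

variable {k : Type v} [NormedField k] {V : Type u} [NormedAddCommGroup V] [NormedSpace k V]

theorem closedSpan_iUnion {ι : Sort*} (A : ι → Set V) :
    closedSpan k (⋃ i, A i) = (⨆ i, closedSpan k (A i)).topologicalClosure := by
  refine le_antisymm ?_ (Submodule.topologicalClosure_minimal _
    (iSup_le fun i => closedSpan_mono (Set.subset_iUnion A i)) (isClosed_closedSpan _))
  rw [closedSpan, Submodule.span_iUnion]
  exact Submodule.topologicalClosure_mono (iSup_mono fun i => Submodule.le_topologicalClosure _)

theorem freeOver_closedSpan_iUnion [IsUltrametricDist k] [IsUltrametricDist V] {ι : Type*}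
    [LinearOrder ι] [WellFoundedLT ι] {A E : ι → Set V}
    (hE : ∀ i, OrthonormalOver (⊥ : Submodule k V) (E i))
    (hAE : ∀ i, closedSpan k (A i) = closedSpan k (E i))
    (hlink : ∀ i, ∀ j < i, A j ⊆ closedSpan k (E i ∩ A j)) :
    FreeOver ⊥ (closedSpan k (⋃ i, A i)) := by
  have hfree : ∀ i, FreeOver (⊥ ⊔ ⨆ j < i, closedSpan k (A j)) (closedSpan k (A i)) := by
    intro i
    have hbasis : closedSpan k (⋃ j : Set.Iio i, E i ∩ A j) = closedSpan k (⋃ j : Set.Iio i, A j) :=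
      le_antisymm (closedSpan_mono (Set.iUnion_mono fun j => Set.inter_subset_right))
        (closedSpan_iUnion_le fun j => ⟨j, hlink i j j.2⟩)
    have hfactor := (hE i).freeOver_of_subset
      (Set.iUnion_subset fun j : Set.Iio i => Set.inter_subset_left (t := A j))
    rw [← hAE, hbasis] at hfactor
    refine hfactor.congr_left ?_
    rw [bot_sup_eq, iSup_subtype', (isClosed_closedSpan _).submodule_topologicalClosure_eq]
    exact closedSpan_iUnion _
  rw [closedSpan_iUnion]
  have htotal := FreeOver.iSup hfree
  rw [bot_sup_eq] at htotal
  exact htotal.of_le_topologicalClosure (Submodule.le_topologicalClosure _) le_rfl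

variable (k V) in
/-- A `μ`-pure set of cardinality at most `μ` together with an orthonormal basis of its closed
span: one entry of the matrix of approximations in the singular compactness argument. -/
structure PureBasis (μ : Cardinal.{u}) where
  carrier : Set V
  basis : Set V
  card_le : #carrier ≤ μ
  isPure : IsPure k μ carrier
  orthonormal : OrthonormalOver (⊥ : Submodule k V) basis
  closedSpan_eq : closedSpan k carrier = closedSpan k basis

namespace PureBasis

variable {Λ : Type u} [LinearOrder Λ] {c : Λ → Cardinal.{u}}

theorem freeOver_closedSpan_iUnion_of_seq [IsUltrametricDist k] [IsUltrametricDist V]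
    [WellFoundedLT Λ] {P : ℕ → ∀ i, PureBasis k V (c i)}
    (hbasis : ∀ n i, (P n i).basis ⊆ (P (n + 1) i).basis)
    (hcarrier : ∀ n i, ∀ j ≤ i, (P n j).carrier ⊆ (P (n + 1) i).carrier)
    (hlink : ∀ n i j, (P n i).carrier ∩ closedSpan k (P n j).basis ⊆
      closedSpan k ((P n j).basis ∩ (P (n + 1) i).carrier)) :
    FreeOver ⊥ (closedSpan k (⋃ i, ⋃ n, (P n i).carrier)) := by
  refine freeOver_closedSpan_iUnion (E := fun i => ⋃ n, (P n i).basis) (fun i => ?_)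
    (fun i => ?_) fun i j hji => Set.iUnion_subset fun n a ha => ?_
  · exact .iUnion_of_directed (monotone_nat_of_le_succ fun n => hbasis n i).directed_le
      fun n => (P n i).orthonormal
  · exact le_antisymm
      (closedSpan_iUnion_le fun n =>
        ⟨n, closedSpan_le_closedSpan.1 (P n i).closedSpan_eq.le⟩)
      (closedSpan_iUnion_le fun n =>
        ⟨n, closedSpan_le_closedSpan.1 (P n i).closedSpan_eq.ge⟩)
  · have hai : a ∈ closedSpan k (P (n + 1) i).basis :=
      (P (n + 1) i).closedSpan_eq.le (subset_closedSpan _ (hcarrier n i j hji.le ha))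
    exact closedSpan_mono (Set.inter_subset_inter
      (Set.subset_iUnion (fun n => (P n i).basis) (n + 1))
      (Set.subset_iUnion (fun n => (P n j).carrier) (n + 2)))
      (hlink (n + 1) j i ⟨hcarrier n j j le_rfl ha, hai⟩)

variable [IsUltrametricDist k] [CompleteSpace k] [TopologicalSpace.SeparableSpace k]
  [IsUltrametricDist V]

theorem exists_subset_carrier {μ : Cardinal.{u}} (hμ : ℵ₀ ≤ μ)
    (hfree : ∀ S : Set V, #S ≤ Order.succ μ → FreeOver ⊥ (closedSpan k S))
    {A : Set V} (hA : #A ≤ μ) : ∃ P : PureBasis k V μ, A ⊆ P.carrier := by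
  obtain ⟨A', hAA', hA', hpure⟩ := exists_isPure hμ hfree hA
  obtain ⟨E, hE, hAE⟩ := (hfree A' (hA'.trans (Order.le_succ μ))).exists_orthonormalOver
  exact ⟨⟨A', E, hA', hpure, hE, hAE⟩, hAA'⟩

theorem exists_extension {μ : Cardinal.{u}} (hμ : ℵ₀ ≤ μ)
    (hfree : ∀ S : Set V, #S ≤ Order.succ μ → FreeOver ⊥ (closedSpan k S))
    (P : PureBasis k V μ) {A : Set V} (hA : #A ≤ μ) (hPA : P.carrier ⊆ A) :
    ∃ Q : PureBasis k V μ, A ⊆ Q.carrier ∧ P.basis ⊆ Q.basis := by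
  obtain ⟨A', hAA', hA', hpure⟩ := exists_isPure hμ hfree hA
  have hPA' := hPA.trans hAA'
  obtain ⟨E, hPE, hE, hAE⟩ := P.orthonormal.exists_extension P.closedSpan_eq hPA'
    (P.isPure A' hPA' hA')
  exact ⟨⟨A', E, hA', hpure, hE, hAE⟩, hAA', hPE⟩

theorem exists_next (hc : ∀ i, ℵ₀ ≤ c i) (hcΛ : ∀ i, #Λ ≤ c i) (hmono : Monotone c)
    (hfree : ∀ i (S : Set V), #S ≤ Order.succ (c i) → FreeOver ⊥ (closedSpan k S))
    (P : ∀ i, PureBasis k V (c i)) :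
    ∃ Q : ∀ i, PureBasis k V (c i), ∀ i, (P i).basis ⊆ (Q i).basis ∧
      (∀ j ≤ i, (P j).carrier ⊆ (Q i).carrier) ∧
      ∀ j, (P i).carrier ∩ closedSpan k (P j).basis ⊆
        closedSpan k ((P j).basis ∩ (Q i).carrier) := by
  have hsupport : ∀ i j, ∃ F ⊆ (P j).basis, #F ≤ c i ∧
      (P i).carrier ∩ closedSpan k (P j).basis ⊆ closedSpan k F := fun i j =>
    exists_subset_mk_le_subset_closedSpan (hc i)
      ((mk_le_mk_of_subset Set.inter_subset_left).trans (P i).card_le) Set.inter_subset_right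
  choose F hFP hF hPF using hsupport
  have hnext : ∀ i, ∃ Q : PureBasis k V (c i),
      ((⋃ j : Set.Iic i, (P j).carrier) ∪ ⋃ j, F i j) ⊆ Q.carrier ∧ (P i).basis ⊆ Q.basis := by
    intro i
    refine exists_extension (hc i) (hfree i) (P i) (mk_union_le_of_le (hc i) ?_ ?_) ?_
    · exact mk_iUnion_le_of_le (hc i) ((mk_set_le _).trans (hcΛ i))
        fun j => (P j).card_le.trans (hmono j.2)
    · exact mk_iUnion_le_of_le (hc i) (hcΛ i) (hF i)
    · exact Set.subset_union_of_subset_left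
        (Set.subset_iUnion (fun j : Set.Iic i => (P j).carrier) ⟨i, le_rfl⟩) _
  choose Q hPQ hbasis using hnext
  refine ⟨Q, fun i => ⟨hbasis i, fun j hj => ?_, fun j => (hPF i j).trans (closedSpan_mono
    (Set.subset_inter (hFP i j) ?_))⟩⟩
  · exact (Set.subset_iUnion (fun j : Set.Iic i => (P j).carrier) ⟨j, hj⟩).trans
      (Set.subset_union_left.trans (hPQ i))
  · exact (Set.subset_iUnion (F i) j).trans (Set.subset_union_right.trans (hPQ i))

end PureBasis

variable [IsUltrametricDist k] [CompleteSpace k] [TopologicalSpace.SeparableSpace k]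
  [IsUltrametricDist V]

theorem exists_superset_freeOver_closedSpan {Λ : Type u} [LinearOrder Λ] [WellFoundedLT Λ]
    {c : Λ → Cardinal.{u}} (hc : ∀ i, ℵ₀ ≤ c i) (hcΛ : ∀ i, #Λ ≤ c i) (hmono : Monotone c)
    (hfree : ∀ i (S : Set V), #S ≤ Order.succ (c i) → FreeOver ⊥ (closedSpan k S))
    {D : Λ → Set V} (hD : ∀ i, #(D i) ≤ c i) :
    ∃ A, (⋃ i, D i) ⊆ A ∧ FreeOver ⊥ (closedSpan k A) := by
  choose P₀ hP₀ using fun i => PureBasis.exists_subset_carrier (hc i) (hfree i) (hD i)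
  choose next hbasis hcarrier hlink using PureBasis.exists_next hc hcΛ hmono hfree
  let P : ℕ → ∀ i, PureBasis k V (c i) := fun n => next^[n] P₀
  have hP : ∀ n, P (n + 1) = next (P n) := fun n => Function.iterate_succ_apply' next n P₀
  refine ⟨_, Set.iUnion_mono fun i => Set.subset_iUnion_of_subset 0 (hP₀ i),
    PureBasis.freeOver_closedSpan_iUnion_of_seq (P := P) (fun n => ?_) (fun n => ?_)
      fun n => ?_⟩ <;> rw [hP]
  · exact hbasis (P n)
  · exact hcarrier (P n)
  · exact hlink (P n)

theorem freeOver_top_of_isSingular {κ : Cardinal.{u}} (hκ : κ.IsSingular) {S : Set V}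
    (hS : #S ≤ κ) (hspan : closedSpan k S = ⊤)
    (hfree : ∀ T : Set V, #T < κ → FreeOver ⊥ (closedSpan k T)) :
    FreeOver (⊥ : Submodule k V) ⊤ := by
  obtain ⟨Λ, _, _, D, hΛ, hD, hDκ, hSD⟩ := exists_filtration_of_isSingular hκ hS
  have haleph0 : ℵ₀ < κ := hκ.aleph0_le.lt_of_ne fun h => not_isSingular_aleph0 (h ▸ hκ)
  let c : Λ → Cardinal.{u} := fun i => max (max ℵ₀ #Λ) #(D i)
  have hc : ∀ i, Order.succ (c i) < κ := fun i =>
    hκ.isSuccLimit.succ_lt (max_lt (max_lt haleph0 hΛ) (hDκ i))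
  obtain ⟨A, hDA, hA⟩ := exists_superset_freeOver_closedSpan (k := k) (c := c)
    (fun i => (le_max_left _ _).trans (le_max_left _ _))
    (fun i => (le_max_right _ _).trans (le_max_left _ _))
    (fun i j hij => max_le_max_left _ (mk_le_mk_of_subset (hD hij)))
    (fun i T hT => hfree T (hT.trans_lt (hc i))) (fun i => le_max_right _ _)
  have htop : closedSpan k A = ⊤ := top_le_iff.1 (hspan ▸ closedSpan_mono (hSD.trans hDA))
  exact htop ▸ hA

end Singular

section Padic

variable (p : ℕ) [Fact p.Prime]

theorem dense_setOf_isAlgebraic_rat : Dense {x : PadicAlgCl p | IsAlgebraic ℚ x} := by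
  intro a
  rw [Metric.mem_closure_iff]
  intro ε hε
  have hint : IsIntegral ℚ_[p] a := (Algebra.IsAlgebraic.isAlgebraic a).isIntegral
  set f := minpoly ℚ_[p] a
  have hn : f.natDegree ≠ 0 := (minpoly.natDegree_pos hint).ne'
  have hM : 0 < max ‖a‖ 1 := lt_max_of_lt_right one_pos
  have hδ : 0 < (ε / max ‖a‖ 1) ^ f.natDegree / (f.natDegree + 1) := by positivity
  obtain ⟨g, hg, hdeg, hcoeff⟩ :=
    Polynomial.exists_monic_and_natDegree_eq_and_norm_map_algebraMap_coeff_sub_lt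
      (Padic.denseRange_ratCast p : DenseRange (algebraMap ℚ ℚ_[p])) (minpoly.monic hint) hδ
  obtain ⟨b, hb, hab⟩ := Polynomial.exists_aroots_norm_sub_lt_of_norm_coeff_sub_lt hδ
    (minpoly.aeval ℚ_[p] a) (minpoly.monic hint) (hg.map _) (by simp [hdeg]) hcoeff
    (IsAlgClosed.splits _)
  refine ⟨b, ⟨g, hg.ne_zero, ?_⟩, ?_⟩
  · simpa only [Polynomial.aeval_map_algebraMap] using (Polynomial.mem_aroots.1 hb).2
  · rw [dist_eq_norm]
    refine hab.trans_eq ?_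
    rw [mul_div_cancel₀ _ (by positivity), Real.pow_rpow_inv_natCast (by positivity) hn,
      div_mul_cancel₀ _ hM.ne']

instance separableSpace_padicComplex : TopologicalSpace.SeparableSpace ℂ_[p] :=
  have : TopologicalSpace.SeparableSpace (PadicAlgCl p) :=
    ⟨_, Algebraic.countable ℚ (PadicAlgCl p), dense_setOf_isAlgebraic_rat p⟩
  inferInstance

end Padic

theorem exists_mk_eq_banachRank (k : Type v) [NormedField k] (V : Type u) [NormedAddCommGroup V]
    [NormedSpace k V] : ∃ S : Set V, #S = banachRank k V ∧ closedSpan k S = ⊤ :=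
  csInf_mem (s := {κ : Cardinal.{u} | ∃ S : Set V, #S = κ ∧ closedSpan k S = ⊤})
    ⟨_, Set.univ, rfl, top_le_iff.1 fun _ _ => subset_closedSpan _ (Set.mem_univ _)⟩

theorem mainTheorem2_general {k : Type v} [NormedField k] [IsUltrametricDist k] [CompleteSpace k]
    [TopologicalSpace.SeparableSpace k] {V : Type u} [NormedAddCommGroup V] [NormedSpace k V]
    [IsUltrametricDist V] [CompleteSpace V]
    (hrank : IsAleph1StronglyCompact (banachRank k V)) :
    IsFreeBanach k V ↔ IsAlmostFreeBanach k V := by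
  refine ⟨fun hV S _ => hV.submodule (isClosed_closedSpan S), fun hV => ?_⟩
  obtain ⟨S, hS, hspan⟩ := exists_mk_eq_banachRank k V
  have hfree : ∀ T : Set V, #T < banachRank k V → FreeOver ⊥ (closedSpan k T) :=
    fun T hT => (hV T hT).freeOver_of_submodule
  rcases isRegular_or_isSingular ((aleph0_le_aleph 1).trans hrank.1) with hreg | hsing
  · exact (hrank.freeOver_top hreg hS.le hspan hfree).isFreeBanach
  · exact (freeOver_top_of_isSingular hsing hS.le hspan hfree).isFreeBanach

theorem mainTheorem2 (p : ℕ) [Fact p.Prime] (k : Subfield ℂ_[p])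
    (hk : IsClosed (k : Set ℂ_[p])) (V : Type u) [NormedAddCommGroup V] [NormedSpace k V]
    [IsUltrametricDist V] [CompleteSpace V] (hV : #V = banachRank k V)
    (hrank : IsAleph1StronglyCompact (banachRank k V)) :
    IsFreeBanach k V ↔ IsAlmostFreeBanach k V :=
  have : CompleteSpace k := hk.completeSpace_coe
  have : SecondCountableTopology ℂ_[p] := UniformSpace.secondCountable_of_separable ℂ_[p]
  mainTheorem2_general hrank
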